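/- Let $A$ and $B$ be real $N\times N$ matrices with $A$ symmetric and non-negative definite, and set $E(t):=e^{-tB}$ and $$C(t):=\int_0^t E(s)\,A\,E(s)^T\,ds .$$ Assume that $C(t)$ is positive definite for every $t>0$ (equivalently, that the Ornstein--Uhlenbeck operator $\mathcal{L}u(x):=\operatorname{tr}\big(A\,D^2u(x)\big)+\langle Bx,Du(x)\rangle$ on $\mathbb{R}^N$ is hypoelliptic), and that every complex eigenvalue of $B$ is purely imaginary, i.e. $\sigma(B)\subseteq i\mathbb{R}$. Then $\mathcal{L}$ has the one-side Liouville property: the functions $u\in C^\infty(\mathbb{R}^N;\mathbb{R})$ that are bounded below and satisfy $\mathcal{L}u=0$ in $\mathbb{R}^N$ are exactly the constant functions. -/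

import Mathlib

open scoped ContDiff

noncomputable section

namespace OrnsteinUhlenbeck

/-- The matrix `E(t) = exp(-tB)`. -/
def E {N : ℕ} (B : Matrix (Fin N) (Fin N) ℝ) (t : ℝ) : Matrix (Fin N) (Fin N) ℝ :=
  NormedSpace.exp (-(t • B))

/-- The matrix `C(t) = ∫₀ᵗ E(s) A E(s)ᵀ ds`, the integral being taken entry by entry. -/
def C {N : ℕ} (A B : Matrix (Fin N) (Fin N) ℝ) (t : ℝ) : Matrix (Fin N) (Fin N) ℝ :=
  Matrix.of fun i j => ∫ s in (0 : ℝ)..t, (E B s * A * (E B s).transpose) i j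

/-- The Hessian matrix `D²u(x)` of second partial derivatives. -/
def hessian {N : ℕ} (u : EuclideanSpace ℝ (Fin N) → ℝ) (x : EuclideanSpace ℝ (Fin N)) :
    Matrix (Fin N) (Fin N) ℝ :=
  Matrix.of fun i j =>
    iteratedFDeriv ℝ 2 u x ![EuclideanSpace.single i 1, EuclideanSpace.single j 1]

/-- The Ornstein–Uhlenbeck operator `ℒu(x) = tr(A D²u(x)) + ⟨Bx, Du(x)⟩`. -/
def L {N : ℕ} (A B : Matrix (Fin N) (Fin N) ℝ) (u : EuclideanSpace ℝ (Fin N) → ℝ)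
    (x : EuclideanSpace ℝ (Fin N)) : ℝ :=
  (A * hessian u x).trace + inner ℝ (Matrix.toEuclideanLin B x) (gradient u x)

/-- The one-side Liouville property: the smooth solutions of `ℒu = 0` in `ℝᴺ` that are bounded
below are exactly the constant functions. -/
def OneSideLiouville {N : ℕ} (A B : Matrix (Fin N) (Fin N) ℝ) : Prop :=
  ∀ u : EuclideanSpace ℝ (Fin N) → ℝ,
    (ContDiff ℝ ∞ u ∧ (∀ x, L A B u x = 0) ∧ BddBelow (Set.range u)) ↔ ∃ c : ℝ, ∀ x, u x = c

end OrnsteinUhlenbeck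

end

/-!
The equation `ℒu = 0` says that `v(t, y) = u(exp(tB) y)` solves the backward heat equation
`∂ₜv + tr(E(t) A E(t)ᵀ D²v) = 0` on all of `ℝ × ℝᴺ`. Its Gaussian kernel between the times `s < t`
has covariance `2(C(t) - C(s))`, so that one expects, for `h, T > 0`,

* `u(x) = ∫ v(T, y) g_{C(T)}(y - x) dy`,
* `u(x') = ∫ v(T, y) g_{C(T) - C(-h)}(y - exp(hB) x') dy`,

where `g_S` is the Gaussian density of covariance `2S`. For nonnegative `u` the kernels may be
compared: by infimal convolution of quadratic forms (`bil_inv_add_le`) the first is at most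
`√(det (C(T) - C(-h)) / det C(T)) · exp(¼⟨(-C(-h))⁻¹ w, w⟩)` times the second, `w = x - exp(hB) x'`.
This is the Harnack inequality `le_exp_mul`. If the spectrum of `B` is imaginary, both `C(T)⁻¹` and
`C(-h)⁻¹` tend to zero (`eventually_le_bil_C`): a direction of bounded covariance would give a
complex eigenvector of `Bᵀ` along which `C` grows linearly. Hence the determinant ratio tends to
`1` as `T → ∞`, and then the exponent to `0` as `h → ∞`. This leaves `u(x) ≤ u(x')` for all
`x, x'`.

Only two inequalities between `u` and its Gaussian averages are needed, and both come from one
computation, which avoids any a priori growth condition. Replace the kernel `g` by `φ(g)`, with `φ`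
convex, vanishing near `0` and asymptotic to the identity; then `φ(g)` has compact support, and an
integration by parts (`hasDerivAt_mass`) shows that `∫ v φ(g)` decreases in time at the rate
`∫ v φ''(g) ⟨A ∇g, ∇g⟩`. Starting the kernel from a concentrated isotropic Gaussian and removing the
truncation by Fatou's lemma, `u` dominates its Gaussian averages (`lintegral_gaussian_le`). As the
covariances exhaust all directions, this forces `v` to be integrable against every Gaussian
(`exists_integral_exp_neg_le`). The rate above then vanishes with the truncation, which gives the
reverse inequality (`mul_setIntegral_le_integral`).
-/

namespace OrnsteinUhlenbeck

open Matrix Set Filter Topology MeasureTheory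

/-! ### Quadratic forms, inverses and determinants of matrices -/

section QuadraticForms

open scoped Matrix.Norms.L2Operator

variable {N : ℕ}

/-- The bilinear form `⟨x, M y⟩` of a matrix `M` on Euclidean space. -/
noncomputable def bil (M : Matrix (Fin N) (Fin N) ℝ) (x y : EuclideanSpace ℝ (Fin N)) : ℝ :=
  inner ℝ x (toEuclideanCLM (𝕜 := ℝ) M y)

lemma bil_eq_dotProduct (M : Matrix (Fin N) (Fin N) ℝ) (x y : EuclideanSpace ℝ (Fin N)) :
    bil M x y = x.ofLp ⬝ᵥ (M *ᵥ y.ofLp) :=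
  inner_toEuclideanCLM M x y

lemma bil_add_left (M : Matrix (Fin N) (Fin N) ℝ) (x y z : EuclideanSpace ℝ (Fin N)) :
    bil M (x + y) z = bil M x z + bil M y z := by simp [bil, inner_add_left]

lemma bil_add_right (M : Matrix (Fin N) (Fin N) ℝ) (x y z : EuclideanSpace ℝ (Fin N)) :
    bil M x (y + z) = bil M x y + bil M x z := by simp [bil, inner_add_right]

lemma bil_sub_left (M : Matrix (Fin N) (Fin N) ℝ) (x y z : EuclideanSpace ℝ (Fin N)) :
    bil M (x - y) z = bil M x z - bil M y z := by simp [bil, inner_sub_left]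

lemma bil_sub_right (M : Matrix (Fin N) (Fin N) ℝ) (x y z : EuclideanSpace ℝ (Fin N)) :
    bil M x (y - z) = bil M x y - bil M x z := by simp [bil, inner_sub_right]

lemma bil_smul_left (M : Matrix (Fin N) (Fin N) ℝ) (c : ℝ) (x y : EuclideanSpace ℝ (Fin N)) :
    bil M (c • x) y = c * bil M x y := by simp [bil, real_inner_smul_left]

lemma bil_smul_right (M : Matrix (Fin N) (Fin N) ℝ) (c : ℝ) (x y : EuclideanSpace ℝ (Fin N)) :
    bil M x (c • y) = c * bil M x y := by simp [bil, real_inner_smul_right]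

lemma bil_neg_right (M : Matrix (Fin N) (Fin N) ℝ) (x y : EuclideanSpace ℝ (Fin N)) :
    bil M x (-y) = -bil M x y := by simp [bil]

lemma bil_zero_left (M : Matrix (Fin N) (Fin N) ℝ) (y : EuclideanSpace ℝ (Fin N)) :
    bil M 0 y = 0 := by simp [bil]

lemma bil_add (M M' : Matrix (Fin N) (Fin N) ℝ) (x y : EuclideanSpace ℝ (Fin N)) :
    bil (M + M') x y = bil M x y + bil M' x y := by simp [bil, inner_add_right]

lemma bil_sub (M M' : Matrix (Fin N) (Fin N) ℝ) (x y : EuclideanSpace ℝ (Fin N)) :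
    bil (M - M') x y = bil M x y - bil M' x y := by simp [bil, inner_sub_right]

lemma bil_smul (c : ℝ) (M : Matrix (Fin N) (Fin N) ℝ) (x y : EuclideanSpace ℝ (Fin N)) :
    bil (c • M) x y = c * bil M x y := by simp [bil, real_inner_smul_right]

lemma bil_one (x y : EuclideanSpace ℝ (Fin N)) :
    bil (1 : Matrix (Fin N) (Fin N) ℝ) x y = inner ℝ x y := by simp [bil]

lemma bil_mul_right (M M' : Matrix (Fin N) (Fin N) ℝ) (x y : EuclideanSpace ℝ (Fin N)) :
    bil (M * M') x y = bil M x (toEuclideanCLM (𝕜 := ℝ) M' y) := by simp [bil]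

lemma bil_mul_left (M M' : Matrix (Fin N) (Fin N) ℝ) (x y : EuclideanSpace ℝ (Fin N)) :
    bil (M * M') x y = bil M' (toEuclideanCLM (𝕜 := ℝ) Mᵀ x) y := by
  simp only [bil_eq_dotProduct, ofLp_toEuclideanCLM, ← mulVec_mulVec, dotProduct_mulVec,
    mulVec_transpose]

lemma bil_comm {M : Matrix (Fin N) (Fin N) ℝ} (hM : M.IsSymm) (x y : EuclideanSpace ℝ (Fin N)) :
    bil M x y = bil M y x := by
  rw [bil_eq_dotProduct, bil_eq_dotProduct, dotProduct_mulVec, ← mulVec_transpose, hM.eq,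
    dotProduct_comm]

lemma abs_bil_le (M : Matrix (Fin N) (Fin N) ℝ) (x y : EuclideanSpace ℝ (Fin N)) :
    |bil M x y| ≤ ‖M‖ * ‖x‖ * ‖y‖ := by
  calc |bil M x y| ≤ ‖x‖ * ‖toEuclideanCLM (𝕜 := ℝ) M y‖ := abs_real_inner_le_norm _ _
    _ ≤ ‖x‖ * (‖M‖ * ‖y‖) := by
        gcongr
        exact (toEuclideanCLM (𝕜 := ℝ) M).le_opNorm y
    _ = _ := by ring

lemma _root_.Matrix.PosDef.isSymm_real {M : Matrix (Fin N) (Fin N) ℝ} (hM : M.PosDef) :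
    M.IsSymm := by
  simpa [Matrix.IsHermitian, Matrix.IsSymm, conjTranspose_eq_transpose_of_trivial] using hM.1

lemma bil_pos {M : Matrix (Fin N) (Fin N) ℝ} (hM : M.PosDef) {x : EuclideanSpace ℝ (Fin N)}
    (hx : x ≠ 0) : 0 < bil M x x := by
  rw [bil_eq_dotProduct]
  simpa using hM.dotProduct_mulVec_pos (x := x.ofLp) (by simpa using hx)

lemma bil_nonneg {M : Matrix (Fin N) (Fin N) ℝ} (hM : M.PosSemidef)
    (x : EuclideanSpace ℝ (Fin N)) : 0 ≤ bil M x x := by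
  rw [bil_eq_dotProduct]
  simpa using hM.dotProduct_mulVec_nonneg x.ofLp

lemma posDef_of_bil_pos {M : Matrix (Fin N) (Fin N) ℝ} (hM : M.IsSymm)
    (h : ∀ x : EuclideanSpace ℝ (Fin N), x ≠ 0 → 0 < bil M x x) : M.PosDef := by
  refine PosDef.of_dotProduct_mulVec_pos ?_ fun x hx => ?_
  · simpa [Matrix.IsHermitian, Matrix.IsSymm, conjTranspose_eq_transpose_of_trivial] using hM
  · have := h (WithLp.toLp 2 x) (by simpa using hx)
    simpa [bil_eq_dotProduct] using this

lemma mul_inv_cancel_of_posDef {M : Matrix (Fin N) (Fin N) ℝ} (hM : M.PosDef) : M * M⁻¹ = 1 :=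
  mul_nonsing_inv _ hM.det_pos.ne'.isUnit

/-- The Fenchel inequality for a positive definite quadratic form and its inverse. -/
lemma two_inner_sub_bil_le {M : Matrix (Fin N) (Fin N) ℝ} (hM : M.PosDef)
    (p z : EuclideanSpace ℝ (Fin N)) : 2 * inner ℝ p z - bil M p p ≤ bil M⁻¹ z z := by
  set q := toEuclideanCLM (𝕜 := ℝ) M⁻¹ z with hq
  have h0 := bil_nonneg hM.posSemidef (p - q)
  have h1 : ∀ r, bil M r q = inner ℝ r z := fun r => by
    rw [hq, ← bil_mul_right, mul_inv_cancel_of_posDef hM, bil_one]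
  have h2 : bil M⁻¹ z z = inner ℝ q z := by
    rw [bil, ← hq, real_inner_comm]
  rw [bil_sub_left, bil_sub_right, bil_sub_right, bil_comm hM.isSymm_real q p, h1, h1] at h0
  rw [h2]
  linarith

lemma bil_inv_eq {M : Matrix (Fin N) (Fin N) ℝ} (hM : M.PosDef) (z : EuclideanSpace ℝ (Fin N)) :
    bil M⁻¹ z z = 2 * inner ℝ (toEuclideanCLM (𝕜 := ℝ) M⁻¹ z) z -
      bil M (toEuclideanCLM (𝕜 := ℝ) M⁻¹ z) (toEuclideanCLM (𝕜 := ℝ) M⁻¹ z) := by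
  set q := toEuclideanCLM (𝕜 := ℝ) M⁻¹ z with hq
  have h1 : bil M q q = inner ℝ q z := by
    conv_lhs => rw [hq, ← bil_mul_right, mul_inv_cancel_of_posDef hM, bil_one]
  have h2 : bil M⁻¹ z z = inner ℝ q z := by
    rw [bil, ← hq, real_inner_comm]
  rw [h1, h2]; ring

/-- The inverse of a sum of positive definite matrices is dominated by the infimal convolution of
the inverse quadratic forms. -/
lemma bil_inv_add_le {M R : Matrix (Fin N) (Fin N) ℝ} (hM : M.PosDef) (hR : R.PosDef)
    (z w : EuclideanSpace ℝ (Fin N)) :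
    bil (M + R)⁻¹ (z + w) (z + w) ≤ bil M⁻¹ z z + bil R⁻¹ w w := by
  rw [bil_inv_eq (hM.add hR)]
  set p := toEuclideanCLM (𝕜 := ℝ) (M + R)⁻¹ (z + w)
  have h1 := two_inner_sub_bil_le hM p z
  have h2 := two_inner_sub_bil_le hR p w
  rw [bil_add, inner_add_right]
  linarith

lemma norm_sq_div_le_bil_inv {M : Matrix (Fin N) (Fin N) ℝ} (hM : M.PosDef) {σ : ℝ} (hσ : 0 < σ)
    (h : ‖M‖ ≤ σ) (z : EuclideanSpace ℝ (Fin N)) : ‖z‖ ^ 2 / σ ≤ bil M⁻¹ z z := by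
  have h1 := two_inner_sub_bil_le hM (σ⁻¹ • z) z
  have h2 := (le_abs_self _).trans (abs_bil_le M z z)
  have h3 : bil M z z ≤ σ * ‖z‖ ^ 2 := by
    refine h2.trans ?_
    rw [mul_assoc, ← sq]
    gcongr
  rw [bil_smul_left, bil_smul_right, real_inner_smul_left, real_inner_self_eq_norm_sq] at h1
  have h4 : σ⁻¹ * (σ⁻¹ * bil M z z) ≤ σ⁻¹ * (σ⁻¹ * (σ * ‖z‖ ^ 2)) := by gcongr
  rw [inv_mul_cancel_left₀ hσ.ne'] at h4
  rw [div_eq_inv_mul]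
  linarith

lemma bil_inv_le_norm_sq_div {M : Matrix (Fin N) (Fin N) ℝ} (hM : M.PosDef) {l : ℝ} (hl : 0 < l)
    (h : ∀ z, l * ‖z‖ ^ 2 ≤ bil M z z) (z : EuclideanSpace ℝ (Fin N)) :
    bil M⁻¹ z z ≤ ‖z‖ ^ 2 / l := by
  rw [bil_inv_eq hM]
  set p := toEuclideanCLM (𝕜 := ℝ) M⁻¹ z
  have h1 := h p
  have h2 := real_inner_le_norm p z
  rw [le_div_iff₀ hl]
  nlinarith [sq_nonneg (l * ‖p‖ - ‖z‖), hl]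

lemma norm_inv_le_of_le_bil {M : Matrix (Fin N) (Fin N) ℝ} (hM : M.PosDef) {l : ℝ} (hl : 0 < l)
    (h : ∀ z, l * ‖z‖ ^ 2 ≤ bil M z z) : ‖M⁻¹‖ ≤ l⁻¹ := by
  rw [cstar_norm_def]
  refine ContinuousLinearMap.opNorm_le_bound _ (by positivity) fun z => ?_
  set p := toEuclideanCLM (𝕜 := ℝ) M⁻¹ z with hp
  have h1 := h p
  have h2 : bil M p p = inner ℝ p z := by
    conv_lhs => rw [hp, ← bil_mul_right, mul_inv_cancel_of_posDef hM, bil_one]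
  have h3 := real_inner_le_norm p z
  rw [inv_mul_eq_div, le_div_iff₀ hl]
  rcases (norm_nonneg p).eq_or_lt with h0 | h0
  · rw [← h0]; simp
  · nlinarith

/-- A positive definite quadratic form is coercive. -/
lemma exists_pos_mul_norm_sq_le_bil {M : Matrix (Fin N) (Fin N) ℝ} (hM : M.PosDef) :
    ∃ l > 0, ∀ z, l * ‖z‖ ^ 2 ≤ bil M z z := by
  refine ⟨(‖M⁻¹‖ + 1)⁻¹, by positivity, fun z => ?_⟩
  have hM' := hM.inv
  have := norm_sq_div_le_bil_inv hM' (σ := ‖M⁻¹‖ + 1) (by positivity) (by linarith) z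
  rwa [nonsing_inv_nonsing_inv _ hM.det_pos.ne'.isUnit, div_eq_inv_mul] at this

lemma hasDerivAt_inv_matrix {S : ℝ → Matrix (Fin N) (Fin N) ℝ} {S' : Matrix (Fin N) (Fin N) ℝ}
    {t : ℝ} (hS : HasDerivAt S S' t) (hdet : (S t).det ≠ 0) :
    HasDerivAt (fun s => (S s)⁻¹) (-((S t)⁻¹ * S' * (S t)⁻¹)) t := by
  simp only [nonsing_inv_eq_ringInverse]
  obtain ⟨x, hx⟩ := (isUnit_iff_isUnit_det (S t)).2 hdet.isUnit
  have h := hasFDerivAt_ringInverse (𝕜 := ℝ) x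
  rw [hx] at h
  have := h.comp_hasDerivAt t hS
  simpa [← hx, Function.comp_def] using this

lemma hasDerivAt_bil_left {S : ℝ → Matrix (Fin N) (Fin N) ℝ} {S' : Matrix (Fin N) (Fin N) ℝ}
    {t : ℝ} (hS : HasDerivAt S S' t) (x y : EuclideanSpace ℝ (Fin N)) :
    HasDerivAt (fun s => bil (S s) x y) (bil S' x y) t := by
  let f : Matrix (Fin N) (Fin N) ℝ →ₗ[ℝ] ℝ :=
    { toFun := fun M => bil M x y
      map_add' := fun M M' => bil_add M M' x y
      map_smul' := fun c M => bil_smul c M x y }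
  exact (LinearMap.toContinuousLinearMap f).hasFDerivAt.comp_hasDerivAt t hS

lemma differentiable_det : Differentiable ℝ (fun M : Matrix (Fin N) (Fin N) ℝ => M.det) := by
  have hentry : ∀ i j, ContDiff ℝ 1 (fun M : Matrix (Fin N) (Fin N) ℝ => M i j) := fun i j =>
    (LinearMap.toContinuousLinearMap (Matrix.entryLinearMap ℝ ℝ i j)).contDiff
  simp only [det_apply]
  refine Differentiable.fun_sum fun σ _ => ?_
  have h : Differentiable ℝ (fun M : Matrix (Fin N) (Fin N) ℝ => ∏ i, M (σ i) i) :=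
    (contDiff_prod fun i _ => hentry (σ i) i).differentiable one_ne_zero
  exact h.const_smul (Equiv.Perm.sign σ)

/-- Jacobi's formula for the derivative of a determinant at an invertible matrix. -/
lemma hasDerivAt_det {S : ℝ → Matrix (Fin N) (Fin N) ℝ} {S' : Matrix (Fin N) (Fin N) ℝ}
    {t : ℝ} (hS : HasDerivAt S S' t) (hdet : (S t).det ≠ 0) :
    HasDerivAt (fun s => (S s).det) ((S t).det * ((S t)⁻¹ * S').trace) t := by
  have hd := (differentiable_det (N := N) (S t)).hasFDerivAt
  have h1 := hd.comp_hasDerivAt t hS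
  have hline : HasDerivAt (fun r : ℝ => S t + r • S') S' 0 := by
    simpa using ((hasDerivAt_id (0 : ℝ)).smul_const S').const_add (S t)
  have h2 : HasDerivAt (fun r : ℝ => (S t + r • S').det)
      (fderiv ℝ (fun M : Matrix (Fin N) (Fin N) ℝ => M.det) (S t) S') 0 := by
    have hd' : HasFDerivAt (fun M : Matrix (Fin N) (Fin N) ℝ => M.det)
        (fderiv ℝ (fun M : Matrix (Fin N) (Fin N) ℝ => M.det) (S t)) (S t + (0 : ℝ) • S') := by
      rw [zero_smul, add_zero]
      exact hd
    exact hd'.comp_hasDerivAt (0 : ℝ) hline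
  have h3 : HasDerivAt (fun r : ℝ => (S t + r • S').det)
      ((S t).det * ((S t)⁻¹ * S').trace) 0 := by
    have heq : (fun r : ℝ => (S t + r • S').det) = fun r : ℝ => (S t).det *
        (1 + ((S t)⁻¹ * S').trace * r +
          (det (1 + (Polynomial.X : Polynomial ℝ) •
            ((S t)⁻¹ * S').map Polynomial.C)).divX.divX.eval r * r ^ 2) := by
      funext r
      rw [← det_one_add_smul, ← det_mul, mul_add, mul_one, mul_smul_comm, ← mul_assoc,
        mul_nonsing_inv _ hdet.isUnit, one_mul]
    rw [heq]
    set P := (det (1 + (Polynomial.X : Polynomial ℝ) •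
            ((S t)⁻¹ * S').map Polynomial.C)).divX.divX
    have := ((((hasDerivAt_id (0 : ℝ)).const_mul (((S t)⁻¹ * S').trace)).const_add 1).add
      ((P.hasDerivAt 0).mul (hasDerivAt_pow 2 (0 : ℝ)))).const_mul (S t).det
    simpa using this
  rw [h2.unique h3] at h1
  exact h1

end QuadraticForms

section Continuity

variable {N : ℕ}

lemma continuous_bil : Continuous fun p : Matrix (Fin N) (Fin N) ℝ × EuclideanSpace ℝ (Fin N) ×
    EuclideanSpace ℝ (Fin N) => bil p.1 p.2.1 p.2.2 := by
  simp only [bil_eq_dotProduct]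
  have h := PiLp.continuous_ofLp 2 (fun _ : Fin N => ℝ)
  exact (h.comp continuous_snd.fst).dotProduct
    (continuous_fst.matrix_mulVec (h.comp continuous_snd.snd))

lemma _root_.Continuous.bil {X : Type*} [TopologicalSpace X] {f : X → Matrix (Fin N) (Fin N) ℝ}
    {g h : X → EuclideanSpace ℝ (Fin N)} (hf : Continuous f) (hg : Continuous g)
    (hh : Continuous h) : Continuous fun x => OrnsteinUhlenbeck.bil (f x) (g x) (h x) := by
  have h1 := hf.prodMk (hg.prodMk hh)
  have h2 := continuous_bil.comp h1
  simpa only [Function.comp_def] using h2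

lemma _root_.ContinuousOn.bil {X : Type*} [TopologicalSpace X] {s : Set X}
    {f : X → Matrix (Fin N) (Fin N) ℝ} {g h : X → EuclideanSpace ℝ (Fin N)}
    (hf : ContinuousOn f s) (hg : ContinuousOn g s) (hh : ContinuousOn h s) :
    ContinuousOn (fun x => OrnsteinUhlenbeck.bil (f x) (g x) (h x)) s := by
  have h1 := hf.prodMk (hg.prodMk hh)
  have h2 := continuous_bil.comp_continuousOn h1
  simpa only [Function.comp_def] using h2

end Continuity

/-! ### The covariance matrices and their growth -/

section Covariance

open scoped Matrix.Norms.L2Operator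

variable {N : ℕ}

lemma E_zero (B : Matrix (Fin N) (Fin N) ℝ) : E B 0 = 1 := by simp [E]

lemma E_eq_exp_smul (B : Matrix (Fin N) (Fin N) ℝ) (t : ℝ) :
    E B t = NormedSpace.exp (t • (-B)) := by simp [E]

lemma E_add (B : Matrix (Fin N) (Fin N) ℝ) (s t : ℝ) : E B (s + t) = E B s * E B t := by
  rw [E_eq_exp_smul, E_eq_exp_smul, E_eq_exp_smul, add_smul]
  exact Matrix.exp_add_of_commute _ _ (((Commute.refl (-B)).smul_left s).smul_right t)

lemma E_mul_E_neg (B : Matrix (Fin N) (Fin N) ℝ) (t : ℝ) : E B t * E B (-t) = 1 := by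
  rw [← E_add, add_neg_cancel, E_zero]

lemma E_neg_left (B : Matrix (Fin N) (Fin N) ℝ) (t : ℝ) : E (-B) t = E B (-t) := by
  simp [E]

lemma hasDerivAt_E (B : Matrix (Fin N) (Fin N) ℝ) (t : ℝ) :
    HasDerivAt (E B) (-(E B t * B)) t := by
  have h := hasDerivAt_exp_smul_const (𝕂 := ℝ) (-B) t
  have h2 : (fun u : ℝ => NormedSpace.exp (u • (-B))) = E B := by
    funext u
    rw [E_eq_exp_smul]
  rw [h2, ← E_eq_exp_smul, mul_neg] at h
  exact h

lemma E_mul_comm (B : Matrix (Fin N) (Fin N) ℝ) (t : ℝ) : E B t * B = B * E B t := by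
  rw [E_eq_exp_smul]
  exact (((Commute.refl B).neg_left.smul_left t).exp_left).eq

lemma hasDerivAt_transpose {S : ℝ → Matrix (Fin N) (Fin N) ℝ} {S' : Matrix (Fin N) (Fin N) ℝ}
    {t : ℝ} (hS : HasDerivAt S S' t) : HasDerivAt (fun s => (S s)ᵀ) S'ᵀ t :=
  (LinearMap.toContinuousLinearMap
    (Matrix.transposeLinearEquiv (Fin N) (Fin N) ℝ ℝ).toLinearMap).hasFDerivAt.comp_hasDerivAt t hS

lemma hasDerivAt_entry {S : ℝ → Matrix (Fin N) (Fin N) ℝ} {S' : Matrix (Fin N) (Fin N) ℝ}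
    {t : ℝ} (hS : HasDerivAt S S' t) (i j : Fin N) : HasDerivAt (fun s => S s i j) (S' i j) t :=
  (LinearMap.toContinuousLinearMap
    (Matrix.entryLinearMap ℝ ℝ i j)).hasFDerivAt.comp_hasDerivAt t hS

lemma hasDerivAt_of_entries {S : ℝ → Matrix (Fin N) (Fin N) ℝ} {S' : Matrix (Fin N) (Fin N) ℝ}
    {t : ℝ} (hS : ∀ i j, HasDerivAt (fun s => S s i j) (S' i j) t) : HasDerivAt S S' t := by
  have h1 : S = fun s => ∑ i, ∑ j, S s i j • Matrix.single i j (1 : ℝ) := by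
    funext s
    conv_lhs => rw [matrix_eq_sum_single (S s)]
    simp [smul_single]
  have h2 : S' = ∑ i, ∑ j, S' i j • Matrix.single i j (1 : ℝ) := by
    conv_lhs => rw [matrix_eq_sum_single S']
    simp [smul_single]
  rw [h1, h2]
  exact HasDerivAt.fun_sum fun i _ => HasDerivAt.fun_sum fun j _ => (hS i j).smul_const _

/-- The integrand `E(t) A E(t)ᵀ` of the covariance matrix. -/
noncomputable def rate (A B : Matrix (Fin N) (Fin N) ℝ) (t : ℝ) : Matrix (Fin N) (Fin N) ℝ :=
  E B t * A * (E B t)ᵀ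

lemma continuous_E (B : Matrix (Fin N) (Fin N) ℝ) : Continuous (E B) :=
  continuous_iff_continuousAt.2 fun t => (hasDerivAt_E B t).continuousAt

lemma continuous_rate (A B : Matrix (Fin N) (Fin N) ℝ) : Continuous (rate A B) := by
  have h := continuous_E B
  unfold rate
  exact (h.mul continuous_const).mul h.matrix_transpose

lemma hasDerivAt_C (A B : Matrix (Fin N) (Fin N) ℝ) (t : ℝ) :
    HasDerivAt (C A B) (rate A B t) t := by
  refine hasDerivAt_of_entries fun i j => ?_
  have hc : Continuous fun s => rate A B s i j := (continuous_rate A B).matrix_elem i j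
  exact intervalIntegral.integral_hasDerivAt_right (hc.intervalIntegrable _ _)
    (hc.stronglyMeasurableAtFilter _ _) hc.continuousAt

lemma C_zero (A B : Matrix (Fin N) (Fin N) ℝ) : C A B 0 = 0 := by
  ext i j
  simp [C]

lemma rate_add (A B : Matrix (Fin N) (Fin N) ℝ) (s t : ℝ) :
    rate A B (s + t) = E B s * rate A B t * (E B s)ᵀ := by
  simp only [rate, E_add, transpose_mul, mul_assoc]

/-- The cocycle identity for the covariance matrices. -/
lemma C_add (A B : Matrix (Fin N) (Fin N) ℝ) (s t : ℝ) :
    C A B (s + t) = C A B s + E B s * C A B t * (E B s)ᵀ := by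
  have hd : ∀ t, HasDerivAt (fun t => C A B (s + t) - E B s * C A B t * (E B s)ᵀ) 0 t := by
    intro t
    have h1 : HasDerivAt (fun t => C A B (s + t)) (rate A B (s + t)) t := by
      simpa using (hasDerivAt_C A B (s + t)).comp_const_add s t
    have h2 : HasDerivAt (fun t => E B s * C A B t * (E B s)ᵀ)
        (E B s * rate A B t * (E B s)ᵀ) t :=
      ((hasDerivAt_C A B t).const_mul (E B s)).mul_const _
    have := h1.sub h2
    rwa [rate_add, sub_self] at this
  have := is_const_of_deriv_eq_zero (fun t => (hd t).differentiableAt) (fun t => (hd t).deriv) t 0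
  simp only [add_zero, C_zero, mul_zero, zero_mul, sub_zero] at this
  rw [← this]
  abel

lemma C_neg_left (A B : Matrix (Fin N) (Fin N) ℝ) (t : ℝ) : C A (-B) t = -C A B (-t) := by
  have hd : ∀ t, HasDerivAt (fun t => C A (-B) t + C A B (-t)) 0 t := by
    intro t
    have h1 := hasDerivAt_C A (-B) t
    have h2 : HasDerivAt (fun t => C A B (-t)) (-rate A B (-t)) t := by
      have h := (hasDerivAt_C A B (-t)).scomp t (hasDerivAt_neg t)
      rw [neg_one_smul] at h
      exact h
    have := h1.add h2
    rwa [rate, E_neg_left, ← rate, add_neg_cancel] at this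
  have := is_const_of_deriv_eq_zero (fun t => (hd t).differentiableAt) (fun t => (hd t).deriv) t 0
  simp only [neg_zero, C_zero, add_zero] at this
  exact eq_neg_of_add_eq_zero_left this

lemma neg_C_neg (A B : Matrix (Fin N) (Fin N) ℝ) (t : ℝ) :
    -C A B (-t) = E B (-t) * C A B t * (E B (-t))ᵀ := by
  have := C_add A B (-t) t
  rw [neg_add_cancel, C_zero] at this
  exact neg_eq_of_add_eq_zero_right this.symm

lemma rate_posSemidef {A : Matrix (Fin N) (Fin N) ℝ} (hA : A.PosSemidef)
    (B : Matrix (Fin N) (Fin N) ℝ) (t : ℝ) : (rate A B t).PosSemidef := by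
  have := hA.mul_mul_conjTranspose_same (E B t)
  rwa [conjTranspose_eq_transpose_of_trivial] at this

lemma posDef_E_mul_mul {M : Matrix (Fin N) (Fin N) ℝ} (hM : M.PosDef)
    (B : Matrix (Fin N) (Fin N) ℝ) (t : ℝ) : (E B t * M * (E B t)ᵀ).PosDef := by
  have h : Function.Injective (E B t).vecMul := by
    intro x y hxy
    have := congrArg (fun z => z ᵥ* E B (-t)) hxy
    simpa [vecMul_vecMul, E_mul_E_neg] using this
  have := hM.mul_mul_conjTranspose_same h
  rwa [conjTranspose_eq_transpose_of_trivial] at this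

lemma C_sub_posDef {A B : Matrix (Fin N) (Fin N) ℝ} (hC : ∀ t : ℝ, 0 < t → (C A B t).PosDef)
    {s t : ℝ} (h : s < t) : (C A B t - C A B s).PosDef := by
  have := C_add A B s (t - s)
  rw [add_sub_cancel] at this
  rw [this, add_sub_cancel_left]
  exact posDef_E_mul_mul (hC _ (sub_pos.2 h)) B s

lemma bil_rate (A B : Matrix (Fin N) (Fin N) ℝ) (t : ℝ) (x y : EuclideanSpace ℝ (Fin N)) :
    bil (rate A B t) x y =
      bil A (toEuclideanCLM (𝕜 := ℝ) (E B t)ᵀ x) (toEuclideanCLM (𝕜 := ℝ) (E B t)ᵀ y) := by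
  rw [rate, bil_mul_right, bil_mul_left]

lemma monotone_bil_C {A : Matrix (Fin N) (Fin N) ℝ} (hA : A.PosSemidef)
    (B : Matrix (Fin N) (Fin N) ℝ) (z : EuclideanSpace ℝ (Fin N)) :
    Monotone fun t => bil (C A B t) z z := by
  have hd := fun t => hasDerivAt_bil_left (hasDerivAt_C A B t) z z
  refine monotone_of_deriv_nonneg (fun t => (hd t).differentiableAt) fun t => ?_
  rw [(hd t).deriv]
  exact bil_nonneg (rate_posSemidef hA B t) z

lemma bil_add_self_le {M : Matrix (Fin N) (Fin N) ℝ} (hM : M.PosSemidef)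
    (x y : EuclideanSpace ℝ (Fin N)) :
    bil M (x + y) (x + y) ≤ 2 * bil M x x + 2 * bil M y y := by
  have := bil_nonneg hM (x - y)
  simp only [bil_sub_left, bil_sub_right] at this
  simp only [bil_add_left, bil_add_right]
  linarith

lemma C_posSemidef {A B : Matrix (Fin N) (Fin N) ℝ} (hC : ∀ t : ℝ, 0 < t → (C A B t).PosDef)
    {t : ℝ} (ht : 0 ≤ t) : (C A B t).PosSemidef := by
  rcases ht.eq_or_lt with rfl | h
  · rw [C_zero]; exact PosSemidef.zero
  · exact (hC t h).posSemidef

/-- The space of directions in which the covariance stays bounded for all positive times. -/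
noncomputable def boundedDirections {A B : Matrix (Fin N) (Fin N) ℝ}
    (hC : ∀ t : ℝ, 0 < t → (C A B t).PosDef) : Submodule ℝ (EuclideanSpace ℝ (Fin N)) where
  carrier := {z | ∃ M, ∀ t, 0 ≤ t → bil (C A B t) z z ≤ M}
  zero_mem' := ⟨0, fun t _ => by rw [bil_zero_left]⟩
  add_mem' := by
    rintro x y ⟨M, hM⟩ ⟨M', hM'⟩
    refine ⟨2 * M + 2 * M', fun t ht => (bil_add_self_le (C_posSemidef hC ht) x y).trans ?_⟩
    have := hM t ht
    have := hM' t ht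
    linarith
  smul_mem' := by
    rintro c x ⟨M, hM⟩
    refine ⟨c * (c * M), fun t ht => ?_⟩
    rw [bil_smul_left, bil_smul_right, ← mul_assoc, ← mul_assoc]
    exact mul_le_mul_of_nonneg_left (hM t ht) (mul_self_nonneg c)

lemma hasDerivAt_toEuclideanCLM {S : ℝ → Matrix (Fin N) (Fin N) ℝ}
    {S' : Matrix (Fin N) (Fin N) ℝ} {t : ℝ} (hS : HasDerivAt S S' t)
    (y : EuclideanSpace ℝ (Fin N)) :
    HasDerivAt (fun s => toEuclideanCLM (𝕜 := ℝ) (S s) y) (toEuclideanCLM (𝕜 := ℝ) S' y) t := by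
  obtain ⟨f, hf⟩ : ∃ f : Matrix (Fin N) (Fin N) ℝ →L[ℝ] EuclideanSpace ℝ (Fin N),
      ∀ M, f M = toEuclideanCLM (𝕜 := ℝ) M y :=
    ⟨LinearMap.toContinuousLinearMap
      { toFun := fun M => toEuclideanCLM (𝕜 := ℝ) M y
        map_add' := fun M M' => by rw [map_add, _root_.add_apply]
        map_smul' := fun c M => by
          rw [map_smul, _root_.smul_apply, RingHom.id_apply] }, fun M => rfl⟩
  have h := f.hasFDerivAt.comp_hasDerivAt t hS
  rw [hf] at h
  exact h.congr_of_eventuallyEq (Eventually.of_forall fun s => (hf (S s)).symm)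

/-- The directions of bounded covariance are invariant under `E(s)ᵀ` for `s ≥ 0` by the cocycle
identity, hence under its derivative `-Bᵀ` at `s = 0` because a subspace is closed. -/
lemma transpose_mem_boundedDirections {A B : Matrix (Fin N) (Fin N) ℝ}
    (hC : ∀ t : ℝ, 0 < t → (C A B t).PosDef) {z : EuclideanSpace ℝ (Fin N)}
    (hz : z ∈ boundedDirections hC) :
    toEuclideanCLM (𝕜 := ℝ) Bᵀ z ∈ boundedDirections hC := by
  have hE : ∀ s : ℝ, 0 ≤ s → toEuclideanCLM (𝕜 := ℝ) (E B s)ᵀ z ∈ boundedDirections hC := by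
    intro s hs
    obtain ⟨M, hM⟩ := hz
    refine ⟨M, fun t ht => ?_⟩
    have h1 := hM (s + t) (by positivity)
    have h2 := bil_nonneg (C_posSemidef hC hs) z
    rw [C_add, bil_add, bil_mul_right, bil_mul_left] at h1
    linarith
  have hd : HasDerivAt (fun s => toEuclideanCLM (𝕜 := ℝ) (E B s)ᵀ z)
      (toEuclideanCLM (𝕜 := ℝ) (-B)ᵀ z) 0 := by
    have := hasDerivAt_toEuclideanCLM (hasDerivAt_transpose (hasDerivAt_E B 0)) z
    rwa [E_zero, one_mul] at this
  have hlim := hd.tendsto_slope_zero_right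
  have hmem : toEuclideanCLM (𝕜 := ℝ) (-B)ᵀ z ∈ boundedDirections hC := by
    refine (boundedDirections hC).closed_of_finiteDimensional.mem_of_tendsto hlim ?_
    filter_upwards [self_mem_nhdsWithin] with s hs
    refine Submodule.smul_mem _ _ (Submodule.sub_mem _ (hE (0 + s) ?_) (hE 0 ?_))
    · simpa using (mem_Ioi.1 hs).le
    · exact le_rfl
  have := Submodule.neg_mem _ hmem
  simpa using this

/-- Two real vectors spanning a plane on which `Bᵀ` acts as an infinitesimal rotation have
covariance growing linearly in time. -/
lemma bil_C_rotation {A B : Matrix (Fin N) (Fin N) ℝ} (hA : A.IsSymm) (θ : ℝ)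
    {a b : EuclideanSpace ℝ (Fin N)} (ha : toEuclideanCLM (𝕜 := ℝ) Bᵀ a = -(θ • b))
    (hb : toEuclideanCLM (𝕜 := ℝ) Bᵀ b = θ • a) (t : ℝ) :
    bil (C A B t) a a + bil (C A B t) b b = t * (bil A a a + bil A b b) := by
  have hder : ∀ (s : ℝ) (z : EuclideanSpace ℝ (Fin N)),
      HasDerivAt (fun s => toEuclideanCLM (𝕜 := ℝ) (E B s)ᵀ z)
        (-toEuclideanCLM (𝕜 := ℝ) (E B s)ᵀ (toEuclideanCLM (𝕜 := ℝ) Bᵀ z)) s := by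
    intro s z
    have := hasDerivAt_toEuclideanCLM (hasDerivAt_transpose (hasDerivAt_E B s)) z
    rw [E_mul_comm, transpose_neg, transpose_mul] at this
    simpa using this
  have hquad : ∀ (s : ℝ) (z : EuclideanSpace ℝ (Fin N)), HasDerivAt
      (fun s => bil A (toEuclideanCLM (𝕜 := ℝ) (E B s)ᵀ z) (toEuclideanCLM (𝕜 := ℝ) (E B s)ᵀ z))
      (2 * bil A (toEuclideanCLM (𝕜 := ℝ) (E B s)ᵀ z)
        (-toEuclideanCLM (𝕜 := ℝ) (E B s)ᵀ (toEuclideanCLM (𝕜 := ℝ) Bᵀ z))) s := by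
    intro s z
    have h1 := (hder s z).inner ℝ
      ((toEuclideanCLM (𝕜 := ℝ) A).hasFDerivAt.comp_hasDerivAt s (hder s z))
    refine h1.congr_deriv ?_
    have := bil_comm hA (-toEuclideanCLM (𝕜 := ℝ) (E B s)ᵀ (toEuclideanCLM (𝕜 := ℝ) Bᵀ z))
      (toEuclideanCLM (𝕜 := ℝ) (E B s)ᵀ z)
    simp only [bil] at this ⊢
    simp only [Function.comp_apply]
    rw [this]
    ring
  have hconst : ∀ s, bil (rate A B s) a a + bil (rate A B s) b b = bil A a a + bil A b b := by
    intro s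
    have hd : ∀ s, HasDerivAt (fun s => bil (rate A B s) a a + bil (rate A B s) b b) 0 s := by
      intro s
      simp only [bil_rate]
      refine ((hquad s a).add (hquad s b)).congr_deriv ?_
      rw [ha, hb]
      simp only [map_neg, map_smul, neg_neg, bil_neg_right, bil_smul_right]
      rw [bil_comm hA (toEuclideanCLM (𝕜 := ℝ) (E B s)ᵀ b)]
      ring
    have := is_const_of_deriv_eq_zero (fun t => (hd t).differentiableAt)
      (fun t => (hd t).deriv) s 0
    simpa [rate, E_zero] using this
  have hd : ∀ t, HasDerivAt (fun t => bil (C A B t) a a + bil (C A B t) b b -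
      t * (bil A a a + bil A b b)) 0 t := by
    intro t
    refine (((hasDerivAt_bil_left (hasDerivAt_C A B t) a a).add
      (hasDerivAt_bil_left (hasDerivAt_C A B t) b b)).sub
      ((hasDerivAt_id t).mul_const (bil A a a + bil A b b))).congr_deriv ?_
    rw [hconst]
    ring
  have := is_const_of_deriv_eq_zero (fun t => (hd t).differentiableAt)
    (fun t => (hd t).deriv) t 0
  have h0 : ∀ z, bil (0 : Matrix (Fin N) (Fin N) ℝ) z z = 0 := fun z => by simp [bil]
  simp only [C_zero, h0, zero_mul, sub_zero, add_zero] at this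
  linarith

/-- If the spectrum of `B` is purely imaginary, no direction has bounded covariance: a nonzero
space of such directions would be invariant under `Bᵀ` and so its complexification would contain an
eigenvector, along which the covariance grows linearly. -/
lemma boundedDirections_eq_bot {A B : Matrix (Fin N) (Fin N) ℝ} (hA : A.PosSemidef)
    (hC : ∀ t : ℝ, 0 < t → (C A B t).PosDef)
    (hB : ∀ z ∈ spectrum ℂ (B.map (algebraMap ℝ ℂ)), z.re = 0) :
    boundedDirections hC = ⊥ := by
  by_contra hne
  obtain ⟨z, hz, hz0⟩ := Submodule.exists_mem_ne_zero_of_ne_bot hne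
  have hAs : A.IsSymm := by
    simpa [Matrix.IsHermitian, Matrix.IsSymm, conjTranspose_eq_transpose_of_trivial] using hA.1
  set V := boundedDirections hC with hV
  let reP : (Fin N → ℂ) → EuclideanSpace ℝ (Fin N) := fun w => WithLp.toLp 2 fun i => (w i).re
  let imP : (Fin N → ℂ) → EuclideanSpace ℝ (Fin N) := fun w => WithLp.toLp 2 fun i => (w i).im
  let W : Submodule ℂ (Fin N → ℂ) :=
    { carrier := {w | reP w ∈ V ∧ imP w ∈ V}
      zero_mem' := by
        have h1 : reP 0 = 0 := by ext i; simp [reP]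
        have h2 : imP 0 = 0 := by ext i; simp [imP]
        exact ⟨h1 ▸ V.zero_mem, h2 ▸ V.zero_mem⟩
      add_mem' := by
        rintro x y ⟨hx1, hx2⟩ ⟨hy1, hy2⟩
        have h1 : reP (x + y) = reP x + reP y := by ext i; simp [reP]
        have h2 : imP (x + y) = imP x + imP y := by ext i; simp [imP]
        exact ⟨h1 ▸ V.add_mem hx1 hy1, h2 ▸ V.add_mem hx2 hy2⟩
      smul_mem' := by
        rintro c x ⟨hx1, hx2⟩
        have h1 : reP (c • x) = c.re • reP x - c.im • imP x := by
          ext i; simp [reP, imP, Complex.mul_re]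
        have h2 : imP (c • x) = c.re • imP x + c.im • reP x := by
          ext i; simp [reP, imP, Complex.mul_im]
        exact ⟨h1 ▸ V.sub_mem (V.smul_mem _ hx1) (V.smul_mem _ hx2),
          h2 ▸ V.add_mem (V.smul_mem _ hx2) (V.smul_mem _ hx1)⟩ }
  let Bc : Matrix (Fin N) (Fin N) ℂ := B.map (algebraMap ℝ ℂ)
  have hre : ∀ w, reP (Bcᵀ *ᵥ w) = toEuclideanCLM (𝕜 := ℝ) Bᵀ (reP w) := by
    intro w
    ext i
    simp [reP, Bc, mulVec, dotProduct, Complex.mul_re]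
  have him : ∀ w, imP (Bcᵀ *ᵥ w) = toEuclideanCLM (𝕜 := ℝ) Bᵀ (imP w) := by
    intro w
    ext i
    simp [imP, Bc, mulVec, dotProduct, Complex.mul_im]
  have hinv : ∀ w ∈ W, Matrix.toLin' Bcᵀ w ∈ W := by
    rintro w ⟨h1, h2⟩
    rw [Matrix.toLin'_apply]
    refine ⟨?_, ?_⟩
    · rw [hre]; exact transpose_mem_boundedDirections hC h1
    · rw [him]; exact transpose_mem_boundedDirections hC h2
  have : Nontrivial W := by
    refine ⟨⟨⟨fun i => (z i : ℂ), ?_, ?_⟩, 0, ?_⟩⟩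
    · have : reP (fun i => (z i : ℂ)) = z := by ext i; simp [reP]
      rw [this]; exact hz
    · have : imP (fun i => (z i : ℂ)) = 0 := by ext i; simp [imP]
      rw [this]; exact V.zero_mem
    · intro h
      refine hz0 ?_
      ext i
      have := congrFun (congrArg Subtype.val h) i
      simpa using this
  obtain ⟨lam, hlam⟩ := Module.End.exists_eigenvalue ((Matrix.toLin' Bcᵀ).restrict hinv)
  obtain ⟨⟨w, hwW⟩, hw⟩ := hlam.exists_hasEigenvector
  have hw0 : w ≠ 0 := fun h => hw.2 (Subtype.ext h)
  have hBw : Bcᵀ *ᵥ w = lam • w := by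
    have := congrArg Subtype.val hw.apply_eq_smul
    simpa using this
  have hspec : lam ∈ spectrum ℂ Bc := by
    have h1 : Module.End.HasEigenvalue (Matrix.toLin' Bcᵀ) lam :=
      Module.End.hasEigenvalue_of_hasEigenvector (x := w)
        ⟨Module.End.mem_eigenspace_iff.2 (by rw [Matrix.toLin'_apply, hBw]), hw0⟩
    have h2 := h1.mem_spectrum
    rw [Matrix.spectrum_toLin', Matrix.mem_spectrum_iff_isRoot_charpoly,
      Matrix.charpoly_transpose, ← Matrix.mem_spectrum_iff_isRoot_charpoly] at h2
    exact h2
  have hlre := hB lam hspec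
  have ha : toEuclideanCLM (𝕜 := ℝ) Bᵀ (reP w) = -(lam.im • imP w) := by
    rw [← hre, hBw]
    ext i
    simp [reP, imP, Complex.mul_re, hlre]
  have hb : toEuclideanCLM (𝕜 := ℝ) Bᵀ (imP w) = lam.im • reP w := by
    rw [← him, hBw]
    ext i
    simp [reP, imP, Complex.mul_im, hlre]
  have hrot := bil_C_rotation hAs lam.im ha hb
  obtain ⟨⟨M1, hM1⟩, ⟨M2, hM2⟩⟩ := hwW
  have hpos : 0 < bil A (reP w) (reP w) + bil A (imP w) (imP w) := by
    have h1 := hrot 1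
    rw [one_mul] at h1
    rw [← h1]
    by_cases hr : reP w = 0
    · have hi : imP w ≠ 0 := by
        intro hi
        refine hw0 (funext fun i => Complex.ext ?_ ?_)
        · simpa [reP] using congrArg (fun v : EuclideanSpace ℝ (Fin N) => v i) hr
        · simpa [imP] using congrArg (fun v : EuclideanSpace ℝ (Fin N) => v i) hi
      exact add_pos_of_nonneg_of_pos (bil_nonneg (hC 1 one_pos).posSemidef _)
        (bil_pos (hC 1 one_pos) hi)
    · exact add_pos_of_pos_of_nonneg (bil_pos (hC 1 one_pos) hr)
        (bil_nonneg (hC 1 one_pos).posSemidef _)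
  set κ := bil A (reP w) (reP w) + bil A (imP w) (imP w)
  have hT : 0 ≤ (|M1 + M2| + 1) / κ := by positivity
  have h1 := hM1 _ hT
  have h2 := hM2 _ hT
  have h3 := hrot ((|M1 + M2| + 1) / κ)
  rw [div_mul_cancel₀ _ hpos.ne'] at h3
  have := le_abs_self (M1 + M2)
  linarith

/-- If the spectrum of `B` is purely imaginary, the smallest eigenvalue of `C(t)` tends to infinity
as `t → ∞`. -/
theorem eventually_le_bil_C {A B : Matrix (Fin N) (Fin N) ℝ} (hA : A.PosSemidef)
    (hC : ∀ t : ℝ, 0 < t → (C A B t).PosDef)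
    (hB : ∀ z ∈ spectrum ℂ (B.map (algebraMap ℝ ℂ)), z.re = 0) (l : ℝ) :
    ∀ᶠ t in atTop, ∀ z, l * ‖z‖ ^ 2 ≤ bil (C A B t) z z := by
  have hcont : ∀ t : ℝ, Continuous fun z : EuclideanSpace ℝ (Fin N) => bil (C A B t) z z :=
    fun t => continuous_const.bil continuous_id continuous_id
  let U : ℕ → Set (EuclideanSpace ℝ (Fin N)) := fun n => {z | l < bil (C A B n) z z}
  have hU : ∀ n, IsOpen (U n) := fun n => isOpen_lt continuous_const (hcont n)
  have hcover : Metric.sphere (0 : EuclideanSpace ℝ (Fin N)) 1 ⊆ ⋃ n, U n := by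
    intro z hz
    by_contra hcon
    have hz0 : z ≠ 0 := by
      rintro rfl
      simp at hz
    refine hz0 ?_
    have : z ∈ boundedDirections hC := by
      refine ⟨l, fun t _ => ?_⟩
      obtain ⟨n, hn⟩ := exists_nat_ge t
      have h1 : ¬ l < bil (C A B n) z z := fun h => hcon (mem_iUnion.2 ⟨n, h⟩)
      exact (monotone_bil_C hA B z hn).trans (not_lt.1 h1)
    rwa [boundedDirections_eq_bot hA hC hB, Submodule.mem_bot] at this
  obtain ⟨n, hn⟩ := (isCompact_sphere (0 : EuclideanSpace ℝ (Fin N)) 1).elim_directed_cover U hU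
    hcover (directed_of_isDirected_le fun m n hmn z hz =>
      lt_of_lt_of_le hz (monotone_bil_C hA B z (Nat.cast_le.2 hmn)))
  filter_upwards [eventually_ge_atTop (n : ℝ)] with t ht z
  rcases eq_or_ne z 0 with rfl | hz0
  · simp [bil_zero_left]
  have hnz : ‖z‖ ≠ 0 := norm_ne_zero_iff.2 hz0
  have h1 : l < bil (C A B n) (‖z‖⁻¹ • z) (‖z‖⁻¹ • z) :=
    hn (by simp [norm_smul, hnz])
  have h2 := h1.le.trans (monotone_bil_C hA B _ ht)
  simp only [bil_smul_left, bil_smul_right] at h2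
  calc l * ‖z‖ ^ 2 ≤ (‖z‖⁻¹ * (‖z‖⁻¹ * bil (C A B t) z z)) * ‖z‖ ^ 2 := by gcongr
    _ = bil (C A B t) z z := by field_simp

end Covariance

/-! ### A convex truncation in logarithmic variables -/

section Truncation

/-- A `C²` truncation of the exponential in logarithmic variables: `trunc a r` vanishes when
`exp r ≤ a`, increases to `exp r` as `a → 0`, and `r = log s` turns it into the convex function
`s (1 - a / s)₊³` of `s`. -/
noncomputable def trunc (a r : ℝ) : ℝ := max (Real.exp r - a) 0 ^ 3 * Real.exp (-r) ^ 2

/-- The first derivative of `trunc a`. -/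
noncomputable def trunc₁ (a r : ℝ) : ℝ :=
  3 * max (Real.exp r - a) 0 ^ 2 * Real.exp (-r) -
    2 * max (Real.exp r - a) 0 ^ 3 * Real.exp (-r) ^ 2

/-- The second derivative of `trunc a`. -/
noncomputable def trunc₂ (a r : ℝ) : ℝ :=
  6 * max (Real.exp r - a) 0 - 9 * max (Real.exp r - a) 0 ^ 2 * Real.exp (-r) +
    4 * max (Real.exp r - a) 0 ^ 3 * Real.exp (-r) ^ 2

lemma hasDerivAt_max_zero_pow (n : ℕ) (x : ℝ) :
    HasDerivAt (fun x : ℝ => max x 0 ^ (n + 2)) ((n + 2) * max x 0 ^ (n + 1)) x := by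
  rcases lt_trichotomy x 0 with h | rfl | h
  · have h1 : (fun x : ℝ => max x 0 ^ (n + 2)) =ᶠ[𝓝 x] fun _ => 0 := by
      filter_upwards [Iio_mem_nhds h] with y hy
      rw [max_eq_right (mem_Iio.1 hy).le]; simp
    rw [max_eq_right h.le]
    simpa using (hasDerivAt_const x (0 : ℝ)).congr_of_eventuallyEq h1
  · rw [hasDerivAt_iff_isLittleO_nhds_zero]
    simp only [zero_add, max_self, ne_eq, Nat.add_eq_zero_iff, OfNat.ofNat_ne_zero, and_false,
      not_false_eq_true, zero_pow, sub_zero, mul_zero, smul_zero, one_ne_zero]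
    have h1 : (fun h : ℝ => max h 0 ^ (n + 2)) =O[𝓝 0] fun h : ℝ => h ^ (n + 2) := by
      refine Asymptotics.IsBigO.of_bound 1 (Eventually.of_forall fun y => ?_)
      rw [one_mul, norm_pow, norm_pow]
      refine pow_le_pow_left₀ (norm_nonneg _) ?_ _
      rw [Real.norm_eq_abs, Real.norm_eq_abs, abs_of_nonneg (le_max_right _ _)]
      exact max_le (le_abs_self y) (abs_nonneg y)
    exact h1.trans_isLittleO
      (by simpa using Asymptotics.isLittleO_pow_id (𝕜 := ℝ) (n := n + 2) (by omega))
  · have h1 : (fun x : ℝ => max x 0 ^ (n + 2)) =ᶠ[𝓝 x] fun x => x ^ (n + 2) := by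
      filter_upwards [Ioi_mem_nhds h] with y hy
      rw [max_eq_left (mem_Ioi.1 hy).le]
    rw [max_eq_left h.le]
    have := (hasDerivAt_pow (n + 2) x).congr_of_eventuallyEq h1
    simpa using this

lemma exp_mul_exp_neg_self (r : ℝ) : Real.exp r * Real.exp (-r) = 1 := by
  rw [← Real.exp_add]; simp

lemma hasDerivAt_exp_neg (r : ℝ) : HasDerivAt (fun r : ℝ => Real.exp (-r)) (-Real.exp (-r)) r := by
  simpa using (hasDerivAt_neg r).exp

lemma hasDerivAt_trunc (a r : ℝ) : HasDerivAt (trunc a) (trunc₁ a r) r := by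
  have h3 := (hasDerivAt_max_zero_pow 1 (Real.exp r - a)).comp r
    ((Real.hasDerivAt_exp r).sub_const a)
  have h := h3.mul ((hasDerivAt_exp_neg r).pow 2)
  refine (h.congr_deriv ?_ :)
  have he := exp_mul_exp_neg_self r
  simp only [trunc₁, Function.comp_apply, Pi.pow_apply]
  push_cast
  linear_combination (3 * max (Real.exp r - a) 0 ^ 2 * Real.exp (-r)) * he

lemma hasDerivAt_trunc₁ (a r : ℝ) : HasDerivAt (trunc₁ a) (trunc₂ a r) r := by
  have h3 := (hasDerivAt_max_zero_pow 1 (Real.exp r - a)).comp r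
    ((Real.hasDerivAt_exp r).sub_const a)
  have h2 := (hasDerivAt_max_zero_pow 0 (Real.exp r - a)).comp r
    ((Real.hasDerivAt_exp r).sub_const a)
  have h := ((h2.const_mul 3).mul (hasDerivAt_exp_neg r)).sub
    ((h3.const_mul 2).mul ((hasDerivAt_exp_neg r).pow 2))
  refine (h.congr_deriv ?_ :)
  have he := exp_mul_exp_neg_self r
  simp only [trunc₂, Function.comp_apply, Pi.pow_apply]
  push_cast
  linear_combination (6 * max (Real.exp r - a) 0 -
    6 * max (Real.exp r - a) 0 ^ 2 * Real.exp (-r)) * he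

lemma continuous_trunc (a : ℝ) : Continuous (trunc a) := by unfold trunc; fun_prop

lemma continuous_trunc₁ (a : ℝ) : Continuous (trunc₁ a) := by unfold trunc₁; fun_prop

lemma continuous_trunc₂ (a : ℝ) : Continuous (trunc₂ a) := by unfold trunc₂; fun_prop

lemma trunc_of_exp_le {a r : ℝ} (h : Real.exp r ≤ a) : trunc a r = 0 := by
  simp [trunc, max_eq_right (sub_nonpos.2 h)]

lemma trunc₁_of_exp_le {a r : ℝ} (h : Real.exp r ≤ a) : trunc₁ a r = 0 := by
  simp [trunc₁, max_eq_right (sub_nonpos.2 h)]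

lemma trunc₂_of_exp_le {a r : ℝ} (h : Real.exp r ≤ a) : trunc₂ a r = 0 := by
  simp [trunc₂, max_eq_right (sub_nonpos.2 h)]

lemma trunc_nonneg (a r : ℝ) : 0 ≤ trunc a r := by unfold trunc; positivity

lemma trunc_le_exp {a : ℝ} (ha : 0 ≤ a) (r : ℝ) : trunc a r ≤ Real.exp r := by
  have h0 : max (Real.exp r - a) 0 ≤ Real.exp r := max_le (by linarith) (Real.exp_pos r).le
  calc trunc a r ≤ Real.exp r ^ 3 * Real.exp (-r) ^ 2 := by unfold trunc; gcongr
    _ = Real.exp r := by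
      have := exp_mul_exp_neg_self r
      linear_combination (Real.exp r ^ 2 * Real.exp (-r) + Real.exp r) * this

lemma exp_sub_le_trunc {a : ℝ} (ha : 0 ≤ a) (r : ℝ) : Real.exp r - 3 * a ≤ trunc a r := by
  have he := exp_mul_exp_neg_self r
  have hp := Real.exp_pos r
  have hn := Real.exp_pos (-r)
  rcases le_total (Real.exp r - a) 0 with h | h
  · rw [trunc_of_exp_le (by linarith)]; linarith
  · rw [trunc, max_eq_left h]
    set s := Real.exp r
    set q := Real.exp (-r)
    have h1 : (s - a) ^ 3 * q ^ 2 = s - 3 * a + a ^ 2 * q * (3 - a * q) := by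
      linear_combination (s ^ 2 * q + s - 3 * a * s * q - 3 * a + 3 * a ^ 2 * q) * he
    have h2 : a * q ≤ 1 := by nlinarith
    rw [h1]
    have : 0 ≤ a ^ 2 * q * (3 - a * q) := mul_nonneg (by positivity) (by linarith)
    linarith

/-- The defect `trunc₂ - trunc₁` is the second derivative in the variable `s = exp r`, up to the
factor `s ^ 2`; it is nonnegative by convexity. -/
lemma trunc₂_sub_trunc₁ (a r : ℝ) : trunc₂ a r - trunc₁ a r =
    6 * max (Real.exp r - a) 0 * (1 - max (Real.exp r - a) 0 * Real.exp (-r)) ^ 2 := by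
  unfold trunc₁ trunc₂; ring

lemma trunc₂_sub_trunc₁_nonneg (a r : ℝ) : 0 ≤ trunc₂ a r - trunc₁ a r := by
  rw [trunc₂_sub_trunc₁]; positivity

/-- The defect is small with `a`, at the price of half of the exponent of `exp r`; for a Gaussian
`exp r` the remaining half is still integrable. -/
lemma trunc₂_sub_trunc₁_le {a : ℝ} (ha : 0 < a) (r : ℝ) :
    trunc₂ a r - trunc₁ a r ≤ 6 * √a * Real.exp (r / 2) := by
  have he := exp_mul_exp_neg_self r
  have hn := Real.exp_pos (-r)
  rcases le_total (Real.exp r) a with h | h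
  · rw [trunc₂_of_exp_le h, trunc₁_of_exp_le h, sub_zero]; positivity
  · rw [trunc₂_sub_trunc₁, max_eq_left (by linarith)]
    have hs : Real.exp r = Real.exp (r / 2) ^ 2 := by rw [← Real.exp_nat_mul]; ring_nf
    have hb := Real.sq_sqrt ha.le
    have hbp := Real.sqrt_pos.2 ha
    set q := Real.exp (-r)
    set σ := Real.exp (r / 2) with hσ
    have hσp : 0 < σ := Real.exp_pos _
    set b := √a
    have hbσ : b ≤ σ := by
      rw [← hb, hs] at h
      exact le_of_sq_le_sq h hσp.le
    rw [hs] at he h ⊢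
    have h1 : 1 - (σ ^ 2 - a) * q = a * q := by linear_combination -he
    rw [h1]
    have hq : q = (σ ^ 2)⁻¹ := (eq_inv_of_mul_eq_one_right he)
    have h2 : (σ ^ 2 - a) * (a * q) ^ 2 ≤ b * σ := by
      calc (σ ^ 2 - a) * (a * q) ^ 2 ≤ σ ^ 2 * (a * q) ^ 2 := by gcongr; linarith
        _ = b ^ 4 / σ ^ 2 := by rw [hq, ← hb]; field_simp
        _ ≤ b * σ := by
          rw [div_le_iff₀ (by positivity)]
          have : b ^ 3 ≤ σ ^ 3 := by gcongr
          nlinarith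
    nlinarith

end Truncation

/-! ### Logarithms of Gaussian densities -/

section LogGaussian

variable {N : ℕ}

/-- The logarithm of the centred Gaussian density of covariance `2S`, up to the additive constant
`-(N / 2) log (4π)`. -/
noncomputable def logG (S : Matrix (Fin N) (Fin N) ℝ) (z : EuclideanSpace ℝ (Fin N)) : ℝ :=
  -(1 / 2) * Real.log S.det - (1 / 4) * bil S⁻¹ z z

lemma hasDerivAt_bil_line {M : Matrix (Fin N) (Fin N) ℝ} (z b c : EuclideanSpace ℝ (Fin N))
    (s : ℝ) :
    HasDerivAt (fun s : ℝ => bil M (z + s • b) c) (bil M b c) s := by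
  simp only [bil_add_left, bil_smul_left]
  simpa using ((hasDerivAt_id s).mul_const (bil M b c)).const_add (bil M z c)

lemma hasLineDerivAt_logG {S : Matrix (Fin N) (Fin N) ℝ} (hS : S.PosDef)
    (z b : EuclideanSpace ℝ (Fin N)) :
    HasLineDerivAt ℝ (logG S) (-(1 / 2) * bil S⁻¹ z b) z b := by
  have h : ∀ s : ℝ, logG S (z + s • b) = logG S z +
      (s * (-(1 / 2) * bil S⁻¹ z b) + s ^ 2 * (-(1 / 4) * bil S⁻¹ b b)) := by
    intro s
    simp only [logG, bil_add_left, bil_add_right, bil_smul_left, bil_smul_right]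
    rw [bil_comm hS.inv.isSymm_real b z]
    ring
  unfold HasLineDerivAt
  simp only [h]
  have := (((hasDerivAt_id (0 : ℝ)).mul_const (-(1 / 2) * bil S⁻¹ z b)).add
    ((hasDerivAt_pow 2 (0 : ℝ)).mul_const (-(1 / 4) * bil S⁻¹ b b))).const_add (logG S z)
  simpa using this

lemma hasLineDerivAt_trunc_logG (a : ℝ) {S : Matrix (Fin N) (Fin N) ℝ} (hS : S.PosDef)
    (x y b : EuclideanSpace ℝ (Fin N)) :
    HasLineDerivAt ℝ (fun y => trunc a (logG S (y - x)))
      (trunc₁ a (logG S (y - x)) * (-(1 / 2) * bil S⁻¹ (y - x) b)) y b := by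
  have h1 : HasDerivAt (fun s : ℝ => logG S (y + s • b - x)) (-(1 / 2) * bil S⁻¹ (y - x) b) 0 := by
    have := hasLineDerivAt_logG hS (y - x) b
    unfold HasLineDerivAt at this
    simpa only [sub_add_eq_add_sub] using this
  have h2 : HasDerivAt (trunc a) (trunc₁ a (logG S (y - x))) (logG S (y + (0 : ℝ) • b - x)) := by
    simpa using hasDerivAt_trunc a (logG S (y - x))
  exact h2.comp (0 : ℝ) h1

lemma hasLineDerivAt_trunc₁_logG (a : ℝ) {S : Matrix (Fin N) (Fin N) ℝ} (hS : S.PosDef)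
    (x y b : EuclideanSpace ℝ (Fin N)) :
    HasLineDerivAt ℝ (fun y => trunc₁ a (logG S (y - x)) * (-(1 / 2) * bil S⁻¹ (y - x) b))
      (trunc₂ a (logG S (y - x)) * (-(1 / 2) * bil S⁻¹ (y - x) b) ^ 2 +
        trunc₁ a (logG S (y - x)) * (-(1 / 2) * bil S⁻¹ b b)) y b := by
  have h1 : HasDerivAt (fun s : ℝ => logG S (y + s • b - x)) (-(1 / 2) * bil S⁻¹ (y - x) b) 0 := by
    have := hasLineDerivAt_logG hS (y - x) b
    unfold HasLineDerivAt at this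
    simpa only [sub_add_eq_add_sub] using this
  have h2 : HasDerivAt (trunc₁ a) (trunc₂ a (logG S (y - x))) (logG S (y + (0 : ℝ) • b - x)) := by
    simpa using hasDerivAt_trunc₁ a (logG S (y - x))
  have h3 : HasDerivAt (fun s : ℝ => -(1 / 2) * bil S⁻¹ (y + s • b - x) b)
      (-(1 / 2) * bil S⁻¹ b b) 0 := by
    have := (hasDerivAt_bil_line (M := S⁻¹) (y - x) b b 0).const_mul (-(1 / 2))
    simpa only [sub_add_eq_add_sub] using this
  have := (h2.comp (0 : ℝ) h1).mul h3
  unfold HasLineDerivAt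
  refine this.congr_deriv ?_
  simp only [Function.comp_apply, zero_smul, add_zero]
  ring

open scoped Matrix.Norms.L2Operator in
/-- The logarithmic heat equation: if `S' = ∑ bₖ bₖᵀ`, the Gaussian densities solve
`∂ₜ g = ∑ D²g(bₖ, bₖ)`. -/
lemma hasDerivAt_logG {S : ℝ → Matrix (Fin N) (Fin N) ℝ} {S' : Matrix (Fin N) (Fin N) ℝ}
    {t : ℝ} (hS : HasDerivAt S S' t) (hpos : (S t).PosDef) {ι : Type*} [Fintype ι]
    (b : ι → EuclideanSpace ℝ (Fin N)) (hb : S' = ∑ k, vecMulVec (b k).ofLp (b k).ofLp)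
    (z : EuclideanSpace ℝ (Fin N)) :
    HasDerivAt (fun s => logG (S s) z)
      (∑ k, (-(1 / 2) * bil (S t)⁻¹ (b k) (b k) + (-(1 / 2) * bil (S t)⁻¹ z (b k)) ^ 2)) t := by
  have hdet := hpos.det_pos.ne'
  have h1 := ((hasDerivAt_det hS hdet).log hdet).const_mul (-(1 / 2))
  have h2 := (hasDerivAt_bil_left (hasDerivAt_inv_matrix hS hdet) z z).const_mul (1 / 4)
  refine (h1.sub h2).congr_deriv ?_
  rw [mul_div_cancel_left₀ _ hdet]
  have htr : ((S t)⁻¹ * S').trace = ∑ k, bil (S t)⁻¹ (b k) (b k) := by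
    rw [hb, Finset.mul_sum, trace_sum]
    refine Finset.sum_congr rfl fun k _ => ?_
    rw [mul_vecMulVec, trace_vecMulVec, bil_eq_dotProduct, dotProduct_comm]
  have hq : bil (-((S t)⁻¹ * S' * (S t)⁻¹)) z z = -∑ k, bil (S t)⁻¹ z (b k) ^ 2 := by
    have hs : ((S t)⁻¹)ᵀ = (S t)⁻¹ := hpos.inv.isSymm_real
    have hsum : ∀ w : EuclideanSpace ℝ (Fin N), bil S' w w = ∑ k, inner ℝ w (b k) ^ 2 := by
      intro w
      rw [bil_eq_dotProduct, hb, sum_mulVec, dotProduct_sum]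
      refine Finset.sum_congr rfl fun k _ => ?_
      rw [vecMulVec_mulVec, op_smul_eq_smul, dotProduct_smul, smul_eq_mul, sq,
        EuclideanSpace.inner_eq_star_dotProduct]
      simp [dotProduct_comm]
    rw [← neg_one_smul ℝ, bil_smul, mul_assoc, bil_mul_left, bil_mul_right, hs, hsum, neg_one_mul]
    congr 1
    refine Finset.sum_congr rfl fun k _ => ?_
    rw [bil_comm hpos.inv.isSymm_real z, bil, real_inner_comm]
  rw [htr, hq, Finset.sum_add_distrib, ← Finset.mul_sum]
  simp only [mul_pow]
  rw [← Finset.mul_sum]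
  ring

end LogGaussian

/-! ### Moving coordinates and directional derivatives -/

section Flow

variable {N : ℕ}

/-- The linear flow `y ↦ exp(tB) y` of the drift. -/
noncomputable def flow (B : Matrix (Fin N) (Fin N) ℝ) (t : ℝ) (y : EuclideanSpace ℝ (Fin N)) :
    EuclideanSpace ℝ (Fin N) :=
  toEuclideanCLM (𝕜 := ℝ) (E B (-t)) y

lemma flow_zero (B : Matrix (Fin N) (Fin N) ℝ) (y : EuclideanSpace ℝ (Fin N)) :
    flow B 0 y = y := by simp [flow, E_zero]

lemma flow_neg_flow (B : Matrix (Fin N) (Fin N) ℝ) (t : ℝ) (y : EuclideanSpace ℝ (Fin N)) :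
    flow B (-t) (flow B t y) = y := by
  rw [flow, flow, ← ContinuousLinearMap.comp_apply, neg_neg]
  change (toEuclideanCLM (𝕜 := ℝ) (E B t) * toEuclideanCLM (𝕜 := ℝ) (E B (-t))) y = y
  rw [← map_mul, E_mul_E_neg, map_one]
  rfl

lemma continuous_flow (B : Matrix (Fin N) (Fin N) ℝ) :
    Continuous fun p : ℝ × EuclideanSpace ℝ (Fin N) => flow B p.1 p.2 := by
  have h := PiLp.continuous_ofLp 2 (fun _ : Fin N => ℝ)
  have h2 := PiLp.continuous_toLp 2 (fun _ : Fin N => ℝ)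
  have hE : Continuous (E B) := continuous_E B
  have h3 : Continuous fun p : ℝ × EuclideanSpace ℝ (Fin N) => E B (-p.1) *ᵥ p.2.ofLp :=
    (hE.comp continuous_fst.neg).matrix_mulVec (h.comp continuous_snd)
  exact h2.comp h3

open scoped Matrix.Norms.L2Operator in
lemma hasDerivAt_flow (B : Matrix (Fin N) (Fin N) ℝ) (t : ℝ) (y : EuclideanSpace ℝ (Fin N)) :
    HasDerivAt (fun s => flow B s y) (toEuclideanCLM (𝕜 := ℝ) B (flow B t y)) t := by
  have h1 : HasDerivAt (fun s => E B (-s)) (B * E B (-t)) t := by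
    have h := (hasDerivAt_E B (-t)).scomp t (hasDerivAt_neg t)
    rw [neg_one_smul, neg_neg, E_mul_comm] at h
    exact h
  have := hasDerivAt_toEuclideanCLM h1 y
  rw [map_mul] at this
  exact this

/-- In the coordinates moving with the flow the diffusion matrix is `E(t) A E(t)ᵀ`. -/
lemma rate_eq_sum {A B : Matrix (Fin N) (Fin N) ℝ} {a : Fin N → EuclideanSpace ℝ (Fin N)}
    (ha : A = ∑ k, vecMulVec (a k).ofLp (a k).ofLp) (t : ℝ) :
    rate A B t = ∑ k, vecMulVec (flow B (-t) (a k)).ofLp (flow B (-t) (a k)).ofLp := by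
  rw [rate, ha, Finset.mul_sum, Finset.sum_mul]
  refine Finset.sum_congr rfl fun k _ => ?_
  rw [flow, neg_neg, ofLp_toEuclideanCLM, mul_vecMulVec, vecMulVec_mul, vecMul_transpose]

open scoped MatrixOrder Matrix.Norms.L2Operator in
lemma exists_eq_sum_vecMulVec {A : Matrix (Fin N) (Fin N) ℝ} (hA : A.PosSemidef) :
    ∃ a : Fin N → EuclideanSpace ℝ (Fin N), A = ∑ k, vecMulVec (a k).ofLp (a k).ofLp := by
  obtain ⟨M, hM⟩ := CStarAlgebra.nonneg_iff_eq_star_mul_self.1 hA.nonneg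
  refine ⟨fun k => WithLp.toLp 2 (M k), ?_⟩
  ext i j
  rw [hM, Matrix.sum_apply, mul_apply]
  simp [vecMulVec_apply, star_apply]

/-- The first derivative of `u` in the direction `b`. -/
noncomputable def dirDeriv (u : EuclideanSpace ℝ (Fin N) → ℝ) (b z : EuclideanSpace ℝ (Fin N)) :
    ℝ :=
  fderiv ℝ u z b

/-- The second derivative of `u` in the direction `b`. -/
noncomputable def dirDeriv₂ (u : EuclideanSpace ℝ (Fin N) → ℝ) (b z : EuclideanSpace ℝ (Fin N)) :
    ℝ :=
  fderiv ℝ (dirDeriv u b) z b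

lemma contDiff_dirDeriv {u : EuclideanSpace ℝ (Fin N) → ℝ} (hu : ContDiff ℝ ∞ u)
    (b : EuclideanSpace ℝ (Fin N)) : ContDiff ℝ ∞ (dirDeriv u b) :=
  (hu.fderiv_right (m := ∞) (by simp)).clm_apply contDiff_const

lemma contDiff_dirDeriv₂ {u : EuclideanSpace ℝ (Fin N) → ℝ} (hu : ContDiff ℝ ∞ u)
    (b : EuclideanSpace ℝ (Fin N)) : ContDiff ℝ ∞ (dirDeriv₂ u b) :=
  ((contDiff_dirDeriv hu b).fderiv_right (m := ∞) (by simp)).clm_apply contDiff_const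

/-- The operator `ℒ` in terms of vectors `aₖ` with `A = ∑ aₖ aₖᵀ`. -/
lemma L_eq_sum {A B : Matrix (Fin N) (Fin N) ℝ} {a : Fin N → EuclideanSpace ℝ (Fin N)}
    (ha : A = ∑ k, vecMulVec (a k).ofLp (a k).ofLp) {u : EuclideanSpace ℝ (Fin N) → ℝ}
    (hu : ContDiff ℝ ∞ u) (x : EuclideanSpace ℝ (Fin N)) :
    L A B u x = ∑ k, dirDeriv₂ u (a k) x + fderiv ℝ u x (toEuclideanCLM (𝕜 := ℝ) B x) := by
  have hd : DifferentiableAt ℝ (fderiv ℝ u) x :=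
    (hu.fderiv_right (m := ∞) (by simp)).differentiable (by simp) x
  have h2 : ∀ b, dirDeriv₂ u b x = fderiv ℝ (fderiv ℝ u) x b b := by
    intro b
    have : fderiv ℝ (dirDeriv u b) x = (fderiv ℝ (fderiv ℝ u) x).flip b := by
      have := (hd.hasFDerivAt.clm_apply (hasFDerivAt_const b x)).fderiv
      unfold dirDeriv
      rw [this]
      ext w
      simp
    rw [dirDeriv₂, this]
    rfl
  have hsum : ∀ b : EuclideanSpace ℝ (Fin N),
      b = ∑ i, b i • EuclideanSpace.single i (1 : ℝ) := by
    intro b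
    ext i
    simp [Finset.sum_apply, Pi.single_apply]
  have h3 : ∀ b : EuclideanSpace ℝ (Fin N), fderiv ℝ (fderiv ℝ u) x b b =
      (vecMulVec b.ofLp b.ofLp * hessian u x).trace := by
    intro b
    conv_lhs => rw [hsum b]
    simp only [map_sum, map_smul, _root_.sum_apply, _root_.smul_apply,
      smul_eq_mul, trace, diag, mul_apply, vecMulVec_apply, hessian, of_apply,
      iteratedFDeriv_two_apply]
    simp only [Matrix.cons_val_zero, Matrix.cons_val_one, Finset.mul_sum]
    refine Finset.sum_congr rfl fun i _ => Finset.sum_congr rfl fun j _ => ?_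
    ring
  have h4 : inner ℝ (toEuclideanLin B x) (gradient u x) =
      fderiv ℝ u x (toEuclideanCLM (𝕜 := ℝ) B x) := by
    rw [real_inner_comm, gradient, InnerProductSpace.toDual_symm_apply]
    rfl
  rw [L, h4, ha, Finset.sum_mul, trace_sum]
  simp only [h2, h3]

end Flow

section IntegrationByParts

variable {N : ℕ}

/-- Two integrations by parts along a fixed direction against a compactly supported function. -/
lemma integral_mul_lineDeriv_two {f f₁ f₂ w w₁ w₂ : EuclideanSpace ℝ (Fin N) → ℝ}
    {b : EuclideanSpace ℝ (Fin N)} {K : Set (EuclideanSpace ℝ (Fin N))} (hK : IsCompact K)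
    (hf : ∀ y, HasLineDerivAt ℝ f (f₁ y) y b) (hf₁ : ∀ y, HasLineDerivAt ℝ f₁ (f₂ y) y b)
    (hw : ∀ y, HasLineDerivAt ℝ w (w₁ y) y b) (hw₁ : ∀ y, HasLineDerivAt ℝ w₁ (w₂ y) y b)
    (cf : Continuous f) (cf₁ : Continuous f₁) (cf₂ : Continuous f₂)
    (cw : Continuous w) (cw₁ : Continuous w₁) (cw₂ : Continuous w₂)
    (sw : ∀ y ∉ K, w y = 0) (sw₁ : ∀ y ∉ K, w₁ y = 0) (sw₂ : ∀ y ∉ K, w₂ y = 0) :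
    ∫ y, f y * w₂ y = ∫ y, f₂ y * w y := by
  have int : ∀ {g h : EuclideanSpace ℝ (Fin N) → ℝ}, Continuous g → Continuous h →
      (∀ y ∉ K, h y = 0) → Integrable fun y => g y * h y := by
    intro g h hg hh hs
    refine (hg.mul hh).integrable_of_hasCompactSupport (HasCompactSupport.intro hK ?_)
    intro y hy
    rw [Pi.mul_apply, hs y hy, mul_zero]
  have h1 := integral_bilinear_hasLineDerivAt_right_eq_neg_left_of_integrable
    (B := ContinuousLinearMap.mul ℝ ℝ) (μ := volume) (f := f) (f' := f₁) (g := w₁) (g' := w₂)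
    (v := b) (int cf₁ cw₁ sw₁) (int cf cw₂ sw₂) (int cf cw₁ sw₁) (fun y _ => hf y)
    (fun y _ => hw₁ y)
  have h2 := integral_bilinear_hasLineDerivAt_right_eq_neg_left_of_integrable
    (B := ContinuousLinearMap.mul ℝ ℝ) (μ := volume) (f := f₁) (f' := f₂) (g := w) (g' := w₁)
    (v := b) (int cf₂ cw sw) (int cf₁ cw₁ sw₁) (int cf₁ cw sw) (fun y _ => hf₁ y)
    (fun y _ => hw y)
  simp only [ContinuousLinearMap.mul_apply'] at h1 h2
  rw [h1, h2, neg_neg]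

lemma hasLineDerivAt_comp_flow {u : EuclideanSpace ℝ (Fin N) → ℝ} (hu : ContDiff ℝ ∞ u)
    (B : Matrix (Fin N) (Fin N) ℝ) (t : ℝ) (a y : EuclideanSpace ℝ (Fin N)) :
    HasLineDerivAt ℝ (fun y => u (flow B t y)) (dirDeriv u a (flow B t y)) y (flow B (-t) a) := by
  have h1 := ((hu.differentiable (by simp)) (flow B t y)).hasFDerivAt
  have h2 : HasFDerivAt (fun y => flow B t y) (toEuclideanCLM (𝕜 := ℝ) (E B (-t))) y :=
    (toEuclideanCLM (𝕜 := ℝ) (E B (-t))).hasFDerivAt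
  have h3 := (h1.comp y h2).hasLineDerivAt (flow B (-t) a)
  have h4 : toEuclideanCLM (𝕜 := ℝ) (E B (-t)) (flow B (-t) a) = a := by
    have := flow_neg_flow B (-t) a
    rwa [neg_neg] at this
  rw [ContinuousLinearMap.comp_apply, h4] at h3
  exact h3

end IntegrationByParts

/-! ### The covariances of a Gaussian transported by the diffusion -/

section CovarianceFamily

variable {N : ℕ}

/-- The covariance at time `t` of the diffusion started at time `t₀` with covariance `P`, in the
coordinates moving with the flow. -/
noncomputable def cov (A B P : Matrix (Fin N) (Fin N) ℝ) (t₀ t : ℝ) : Matrix (Fin N) (Fin N) ℝ :=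
  P + (C A B t - C A B t₀)

lemma cov_self (A B P : Matrix (Fin N) (Fin N) ℝ) (t₀ : ℝ) : cov A B P t₀ t₀ = P := by
  simp [cov]

lemma cov_posDef {A B P : Matrix (Fin N) (Fin N) ℝ} (hC : ∀ t : ℝ, 0 < t → (C A B t).PosDef)
    (hP : P.PosDef) {t₀ t : ℝ} (h : t₀ ≤ t) : (cov A B P t₀ t).PosDef := by
  rcases h.eq_or_lt with rfl | h
  · rwa [cov_self]
  · exact hP.add (C_sub_posDef hC h)

lemma continuousAt_matrix_inv {M : Matrix (Fin N) (Fin N) ℝ} (hM : M.det ≠ 0) :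
    ContinuousAt (fun M : Matrix (Fin N) (Fin N) ℝ => M⁻¹) M := by
  simp only [inv_def, Ring.inverse_eq_inv']
  exact (continuous_id.matrix_det.continuousAt.inv₀ hM).smul
    continuous_id.matrix_adjugate.continuousAt

lemma continuous_cov (A B P : Matrix (Fin N) (Fin N) ℝ) (t₀ : ℝ) :
    Continuous (cov A B P t₀) := by
  have h : Continuous (C A B) := by
    refine continuous_matrix fun i j => continuous_iff_continuousAt.2 fun t => ?_
    exact (hasDerivAt_entry (hasDerivAt_C A B t) i j).continuousAt
  exact continuous_const.add (h.sub continuous_const)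

open scoped Matrix.Norms.L2Operator in
lemma hasDerivAt_cov (A B P : Matrix (Fin N) (Fin N) ℝ) (t₀ t : ℝ) :
    HasDerivAt (cov A B P t₀) (rate A B t) t :=
  ((hasDerivAt_C A B t).sub_const _).const_add _

lemma continuousOn_inv_cov {A B P : Matrix (Fin N) (Fin N) ℝ}
    (hC : ∀ t : ℝ, 0 < t → (C A B t).PosDef) (hP : P.PosDef) (t₀ : ℝ) :
    ContinuousOn (fun t => (cov A B P t₀ t)⁻¹) (Ici t₀) := fun _ ht =>
  ((continuousAt_matrix_inv (cov_posDef hC hP ht).det_pos.ne').comp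
    (continuous_cov A B P t₀).continuousAt).continuousWithinAt

lemma continuousOn_logG_cov {A B P : Matrix (Fin N) (Fin N) ℝ}
    (hC : ∀ t : ℝ, 0 < t → (C A B t).PosDef) (hP : P.PosDef) (t₀ : ℝ)
    (x : EuclideanSpace ℝ (Fin N)) :
    ContinuousOn (fun p : ℝ × EuclideanSpace ℝ (Fin N) => logG (cov A B P t₀ p.1) (p.2 - x))
      (Ici t₀ ×ˢ univ) := by
  have hfst : MapsTo Prod.fst (Ici t₀ ×ˢ (univ : Set (EuclideanSpace ℝ (Fin N)))) (Ici t₀) :=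
    fun p hp => hp.1
  have hz : ContinuousOn (fun p : ℝ × EuclideanSpace ℝ (Fin N) => p.2 - x) (Ici t₀ ×ˢ univ) := by
    fun_prop
  have h1 : ContinuousOn (fun p : ℝ × EuclideanSpace ℝ (Fin N) => (cov A B P t₀ p.1)⁻¹)
      (Ici t₀ ×ˢ univ) := (continuousOn_inv_cov hC hP t₀).comp continuousOn_fst hfst
  have h2 : ContinuousOn (fun p : ℝ × EuclideanSpace ℝ (Fin N) =>
      Real.log (cov A B P t₀ p.1).det) (Ici t₀ ×ˢ univ) :=
    ((continuous_cov A B P t₀).matrix_det.comp continuous_fst).continuousOn.log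
      fun p hp => (cov_posDef hC hP hp.1).det_pos.ne'
  exact (continuousOn_const.mul h2).sub (continuousOn_const.mul (h1.bil hz hz))

open scoped Matrix.Norms.L2Operator in
/-- On a compact time interval, the Gaussian densities are dominated by one Gaussian. -/
lemma exists_logG_cov_le {A B P : Matrix (Fin N) (Fin N) ℝ}
    (hC : ∀ t : ℝ, 0 < t → (C A B t).PosDef) (hP : P.PosDef) (t₀ T : ℝ) :
    ∃ δ > 0, ∃ D, ∀ t ∈ Icc t₀ T, ∀ z, logG (cov A B P t₀ t) z ≤ D - δ * ‖z‖ ^ 2 := by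
  have hcont : ContinuousOn (fun t => ‖cov A B P t₀ t‖) (Icc t₀ T) := fun t _ =>
    (hasDerivAt_cov A B P t₀ t).continuousAt.norm.continuousWithinAt
  obtain ⟨σ, hσ⟩ := isCompact_Icc.bddAbove_image hcont
  have hlog : ContinuousOn (fun t => -(1 / 2) * Real.log (cov A B P t₀ t).det) (Icc t₀ T) :=
    continuousOn_const.mul ((continuous_cov A B P t₀).matrix_det.continuousOn.log
      fun t ht => (cov_posDef hC hP ht.1).det_pos.ne')
  obtain ⟨D, hD⟩ := isCompact_Icc.bddAbove_image hlog
  refine ⟨1 / (4 * (|σ| + 1)), by positivity, D, fun t ht z => ?_⟩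
  have h1 := hD (mem_image_of_mem _ ht)
  have h2 : ‖cov A B P t₀ t‖ ≤ |σ| + 1 := by
    have := hσ (mem_image_of_mem _ ht)
    have h3 := le_abs_self σ
    linarith
  have h3 := norm_sq_div_le_bil_inv (cov_posDef hC hP ht.1) (by positivity) h2 z
  have h4 : 1 / (4 * (|σ| + 1)) * ‖z‖ ^ 2 = 1 / 4 * (‖z‖ ^ 2 / (|σ| + 1)) := by
    field_simp
  rw [h4, logG]
  linarith

/-- The truncated Gaussians have a common compact support on a compact time interval. -/
lemma exists_exp_logG_cov_le {A B P : Matrix (Fin N) (Fin N) ℝ}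
    (hC : ∀ t : ℝ, 0 < t → (C A B t).PosDef) (hP : P.PosDef) (t₀ T : ℝ)
    (x : EuclideanSpace ℝ (Fin N)) {a : ℝ} (ha : 0 < a) :
    ∃ ρ, ∀ t ∈ Icc t₀ T, ∀ y ∉ Metric.closedBall x ρ,
      Real.exp (logG (cov A B P t₀ t) (y - x)) ≤ a := by
  obtain ⟨δ, hδ, D, hD⟩ := exists_logG_cov_le hC hP t₀ T
  refine ⟨√(|D - Real.log a| / δ), fun t ht y hy => ?_⟩
  rw [Metric.mem_closedBall, dist_eq_norm, not_le] at hy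
  have h1 := hD t ht (y - x)
  have h2 : |D - Real.log a| / δ ≤ ‖y - x‖ ^ 2 := by
    rw [← Real.sq_sqrt (show 0 ≤ |D - Real.log a| / δ by positivity)]
    gcongr
  rw [div_le_iff₀ hδ] at h2
  have h3 := le_abs_self (D - Real.log a)
  rw [← Real.exp_log ha]
  apply Real.exp_le_exp.2
  linarith

end CovarianceFamily

/-! ### Truncated masses and their dissipation -/

section Mass

variable {N : ℕ}

lemma continuous_of_continuousOn_prod {X Y Z : Type*} [TopologicalSpace X] [TopologicalSpace Y]
    [TopologicalSpace Z] {F : X × Y → Z} {s : Set X} (h : ContinuousOn F (s ×ˢ univ)) {t : X}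
    (ht : t ∈ s) : Continuous fun y => F (t, y) := by
  rw [← continuousOn_univ]
  exact h.comp (by fun_prop) fun y _ => ⟨ht, mem_univ _⟩

/-- The integral at time `t` of `u`, in moving coordinates, against the truncated Gaussian started
at time `t₀` from `x` with covariance `2P`. -/
noncomputable def mass (A B P : Matrix (Fin N) (Fin N) ℝ) (u : EuclideanSpace ℝ (Fin N) → ℝ)
    (x : EuclideanSpace ℝ (Fin N)) (a t₀ t : ℝ) : ℝ :=
  ∫ y, u (flow B t y) * trunc a (logG (cov A B P t₀ t) (y - x))

/-- The squared gradient of the logarithmic Gaussian along the diffusion directions. -/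
noncomputable def gradSq (A B P : Matrix (Fin N) (Fin N) ℝ) (d : Fin N → EuclideanSpace ℝ (Fin N))
    (t₀ t : ℝ) (z : EuclideanSpace ℝ (Fin N)) : ℝ :=
  ∑ k, (-(1 / 2) * bil (cov A B P t₀ t)⁻¹ z (flow B (-t) (d k))) ^ 2

lemma gradSq_nonneg (A B P : Matrix (Fin N) (Fin N) ℝ) (d : Fin N → EuclideanSpace ℝ (Fin N))
    (t₀ t : ℝ) (z : EuclideanSpace ℝ (Fin N)) : 0 ≤ gradSq A B P d t₀ t z :=
  Finset.sum_nonneg fun _ _ => sq_nonneg _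

/-- The rate at which the truncated mass decreases. -/
noncomputable def dissipation (A B P : Matrix (Fin N) (Fin N) ℝ)
    (d : Fin N → EuclideanSpace ℝ (Fin N)) (u : EuclideanSpace ℝ (Fin N) → ℝ)
    (x : EuclideanSpace ℝ (Fin N)) (a t₀ t : ℝ) : ℝ :=
  ∫ y, u (flow B t y) * ((trunc₂ a (logG (cov A B P t₀ t) (y - x)) -
    trunc₁ a (logG (cov A B P t₀ t) (y - x))) * gradSq A B P d t₀ t (y - x))

lemma continuous_flow_right (B : Matrix (Fin N) (Fin N) ℝ) (t : ℝ) :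
    Continuous fun y => flow B t y :=
  (toEuclideanCLM (𝕜 := ℝ) (E B (-t))).continuous

lemma continuous_logG (S : Matrix (Fin N) (Fin N) ℝ) : Continuous (logG S) :=
  continuous_const.sub (continuous_const.mul (continuous_const.bil continuous_id continuous_id))

lemma continuous_flow_comp {u : EuclideanSpace ℝ (Fin N) → ℝ} (hu : Continuous u)
    (B : Matrix (Fin N) (Fin N) ℝ) :
    Continuous fun p : ℝ × EuclideanSpace ℝ (Fin N) => u (flow B p.1 p.2) :=
  hu.comp (continuous_flow B)

lemma continuousOn_mass {A B P : Matrix (Fin N) (Fin N) ℝ} {u : EuclideanSpace ℝ (Fin N) → ℝ}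
    (hC : ∀ t : ℝ, 0 < t → (C A B t).PosDef) (hP : P.PosDef) (hu : Continuous u)
    (x : EuclideanSpace ℝ (Fin N)) {a : ℝ} (ha : 0 < a) (t₀ T : ℝ) :
    ContinuousOn (mass A B P u x a t₀) (Icc t₀ T) := by
  obtain ⟨ρ, hρ⟩ := exists_exp_logG_cov_le hC hP t₀ T x ha
  refine continuousOn_integral_of_compact_support (isCompact_closedBall x ρ) ?_ ?_
  · have hsub : Icc t₀ T ×ˢ (univ : Set (EuclideanSpace ℝ (Fin N))) ⊆ Ici t₀ ×ˢ univ :=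
      prod_mono Icc_subset_Ici_self (subset_refl univ)
    have h1 := (continuousOn_logG_cov hC hP t₀ x).mono hsub
    exact (continuous_flow_comp hu B).continuousOn.mul
      ((continuous_trunc a).comp_continuousOn h1)
  · intro t y ht hy
    rw [trunc_of_exp_le (hρ t ht y hy), mul_zero]

set_option maxHeartbeats 400000 in
/-- The time derivative of the truncated mass of an `ℒ`-harmonic function: the Gaussian solves the
adjoint equation, so that only the term from the second derivative of the truncation is left. -/
theorem hasDerivAt_mass {A B P : Matrix (Fin N) (Fin N) ℝ}
    {d : Fin N → EuclideanSpace ℝ (Fin N)} (hd : A = ∑ k, vecMulVec (d k).ofLp (d k).ofLp)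
    {u : EuclideanSpace ℝ (Fin N) → ℝ} (hu : ContDiff ℝ ∞ u) (hL : ∀ x, L A B u x = 0)
    (hC : ∀ t : ℝ, 0 < t → (C A B t).PosDef) (hP : P.PosDef)
    (x : EuclideanSpace ℝ (Fin N)) {a : ℝ} (ha : 0 < a) {t₀ t : ℝ} (ht : t₀ < t) :
    HasDerivAt (mass A B P u x a t₀) (-dissipation A B P d u x a t₀ t) t := by
  obtain ⟨ρ, hρ⟩ := exists_exp_logG_cov_le hC hP t₀ (t + 1) x ha
  have hKc := isCompact_closedBall x ρ
  set K := Metric.closedBall x ρ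
  -- the quantities entering the derivative, as functions of time and space
  let ℓ : ℝ × EuclideanSpace ℝ (Fin N) → ℝ := fun p => logG (cov A B P t₀ p.1) (p.2 - x)
  let bb : Fin N → ℝ × EuclideanSpace ℝ (Fin N) → ℝ := fun k p =>
    -(1 / 2) * bil (cov A B P t₀ p.1)⁻¹ (flow B (-p.1) (d k)) (flow B (-p.1) (d k))
  let zb : Fin N → ℝ × EuclideanSpace ℝ (Fin N) → ℝ := fun k p =>
    -(1 / 2) * bil (cov A B P t₀ p.1)⁻¹ (p.2 - x) (flow B (-p.1) (d k))
  let v : ℝ × EuclideanSpace ℝ (Fin N) → ℝ := fun p => u (flow B p.1 p.2)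
  let v₁ : Fin N → ℝ × EuclideanSpace ℝ (Fin N) → ℝ := fun k p =>
    dirDeriv u (d k) (flow B p.1 p.2)
  let v₂ : Fin N → ℝ × EuclideanSpace ℝ (Fin N) → ℝ := fun k p =>
    dirDeriv₂ u (d k) (flow B p.1 p.2)
  let G : ℝ × EuclideanSpace ℝ (Fin N) → ℝ := fun p =>
    (-∑ k, v₂ k p) * trunc a (ℓ p) + v p * (trunc₁ a (ℓ p) * ∑ k, (bb k p + zb k p ^ 2))
  have cℓ : ContinuousOn ℓ (Ici t₀ ×ˢ univ) := continuousOn_logG_cov hC hP t₀ x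
  have cS : ContinuousOn (fun p : ℝ × EuclideanSpace ℝ (Fin N) => (cov A B P t₀ p.1)⁻¹)
      (Ici t₀ ×ˢ univ) := (continuousOn_inv_cov hC hP t₀).comp continuousOn_fst fun p hp => hp.1
  have cb : ∀ k, ContinuousOn (fun p : ℝ × EuclideanSpace ℝ (Fin N) => flow B (-p.1) (d k))
      (Ici t₀ ×ˢ univ) := fun k =>
    ((continuous_flow B).comp (continuous_fst.neg.prodMk continuous_const)).continuousOn
  have cz : ContinuousOn (fun p : ℝ × EuclideanSpace ℝ (Fin N) => p.2 - x)
      (Ici t₀ ×ˢ univ) := by fun_prop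
  have cbb : ∀ k, ContinuousOn (bb k) (Ici t₀ ×ˢ univ) := fun k =>
    continuousOn_const.mul (cS.bil (cb k) (cb k))
  have czb : ∀ k, ContinuousOn (zb k) (Ici t₀ ×ˢ univ) := fun k =>
    continuousOn_const.mul (cS.bil cz (cb k))
  have cv : Continuous v := continuous_flow_comp hu.continuous B
  have cv₁ : ∀ k, Continuous (v₁ k) := fun k =>
    continuous_flow_comp (contDiff_dirDeriv hu (d k)).continuous B
  have cv₂ : ∀ k, Continuous (v₂ k) := fun k =>
    continuous_flow_comp (contDiff_dirDeriv₂ hu (d k)).continuous B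
  have ct : ContinuousOn (fun p => trunc a (ℓ p)) (Ici t₀ ×ˢ univ) :=
    (continuous_trunc a).comp_continuousOn cℓ
  have ct₁ : ContinuousOn (fun p => trunc₁ a (ℓ p)) (Ici t₀ ×ˢ univ) :=
    (continuous_trunc₁ a).comp_continuousOn cℓ
  have ct₂ : ContinuousOn (fun p => trunc₂ a (ℓ p)) (Ici t₀ ×ˢ univ) :=
    (continuous_trunc₂ a).comp_continuousOn cℓ
  have cG : ContinuousOn G (Ici t₀ ×ˢ univ) := by
    refine ((continuousOn_finsetSum _ fun k _ => (cv₂ k).continuousOn).neg.mul ct).add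
      (cv.continuousOn.mul (ct₁.mul (continuousOn_finsetSum _ fun k _ => ?_)))
    exact (cbb k).add ((czb k).pow 2)
  have hts : ∀ s ∈ Icc t₀ (t + 1), ∀ y ∉ K, trunc a (ℓ (s, y)) = 0 := fun s hs y hy =>
    trunc_of_exp_le (hρ s hs y hy)
  have hts₁ : ∀ s ∈ Icc t₀ (t + 1), ∀ y ∉ K, trunc₁ a (ℓ (s, y)) = 0 := fun s hs y hy =>
    trunc₁_of_exp_le (hρ s hs y hy)
  have hts₂ : ∀ s ∈ Icc t₀ (t + 1), ∀ y ∉ K, trunc₂ a (ℓ (s, y)) = 0 := fun s hs y hy =>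
    trunc₂_of_exp_le (hρ s hs y hy)
  have hGs : ∀ s ∈ Icc t₀ (t + 1), ∀ y ∉ K, G (s, y) = 0 := fun s hs y hy => by
    simp only [G, hts s hs y hy, hts₁ s hs y hy, mul_zero, zero_mul, add_zero]
  have hpt : ∀ y, ∀ s ∈ Ioo t₀ (t + 1), HasDerivAt
      (fun s => u (flow B s y) * trunc a (logG (cov A B P t₀ s) (y - x))) (G (s, y)) s := by
    intro y s hs
    have h1 := ((hu.differentiable (by simp)) (flow B s y)).hasFDerivAt.comp_hasDerivAt s
      (hasDerivAt_flow B s y)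
    have h2 : fderiv ℝ u (flow B s y) (toEuclideanCLM (𝕜 := ℝ) B (flow B s y)) =
        -∑ k, v₂ k (s, y) := by
      have := L_eq_sum hd hu (flow B s y) (B := B)
      rw [hL] at this
      simp only [v₂]
      linarith
    rw [h2] at h1
    have h3 := hasDerivAt_logG (hasDerivAt_cov A B P t₀ s) (cov_posDef hC hP hs.1.le)
      (fun k => flow B (-s) (d k)) (rate_eq_sum hd s) (y - x)
    have h4 := HasDerivAt.comp (h := fun s => logG (cov A B P t₀ s) (y - x)) s
      (hasDerivAt_trunc a (logG (cov A B P t₀ s) (y - x))) h3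
    exact h1.mul h4
  obtain ⟨M, hM⟩ : ∃ M, ∀ s ∈ Icc t₀ (t + 1), ∀ y ∈ K, ‖G (s, y)‖ ≤ M := by
    have hcpt : IsCompact (Icc t₀ (t + 1) ×ˢ K) := isCompact_Icc.prod hKc
    have hc : ContinuousOn (fun p => ‖G p‖) (Icc t₀ (t + 1) ×ˢ K) :=
      (cG.mono (prod_mono Icc_subset_Ici_self (subset_univ K))).norm
    obtain ⟨M, hM⟩ := hcpt.bddAbove_image hc
    exact ⟨M, fun s hs y hy => hM (mem_image_of_mem _ (mk_mem_prod hs hy))⟩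
  have htI : t ∈ Icc t₀ (t + 1) := ⟨ht.le, by linarith⟩
  have hnhds : Ioo t₀ (t + 1) ∈ 𝓝 t := Ioo_mem_nhds ht (by linarith)
  have hFc : ∀ s, t₀ ≤ s → Continuous fun y => u (flow B s y) *
      trunc a (logG (cov A B P t₀ s) (y - x)) := fun s hs =>
    continuous_of_continuousOn_prod (cv.continuousOn.mul ct) hs
  have cpt : ∀ {F : EuclideanSpace ℝ (Fin N) → ℝ}, Continuous F → (∀ y ∉ K, F y = 0) →
      Integrable F := fun hF hs =>
    hF.integrable_of_hasCompactSupport (HasCompactSupport.intro hKc hs)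
  have hder := (hasDerivAt_integral_of_dominated_loc_of_deriv_le (μ := volume)
    (F := fun s y => u (flow B s y) * trunc a (logG (cov A B P t₀ s) (y - x)))
    (F' := fun s y => G (s, y)) (bound := K.indicator fun _ => M) hnhds
    (by
      filter_upwards [hnhds] with s hs
      exact (hFc s hs.1.le).aestronglyMeasurable)
    (cpt (hFc t ht.le) fun y hy => by
      have := hts t htI y hy
      simp only [ℓ] at this
      rw [this, mul_zero])
    (continuous_of_continuousOn_prod cG ht.le).aestronglyMeasurable
    (Eventually.of_forall fun y s hs => by
      by_cases hy : y ∈ K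
      · rw [indicator_of_mem hy]
        exact hM s (Ioo_subset_Icc_self hs) y hy
      · rw [indicator_of_notMem hy, hGs s (Ioo_subset_Icc_self hs) y hy, norm_zero])
    ((integrable_indicator_iff hKc.measurableSet).2
      (integrableOn_const (hs := hKc.measure_lt_top.ne)))
    (Eventually.of_forall hpt)).2
  refine hder.congr_deriv ?_
  -- integrate by parts along each diffusion direction
  have sl : ∀ {F : ℝ × EuclideanSpace ℝ (Fin N) → ℝ}, ContinuousOn F (Ici t₀ ×ˢ univ) →
      Continuous fun y => F (t, y) := fun h => continuous_of_continuousOn_prod h ht.le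
  have hpos := cov_posDef hC hP ht.le (t₀ := t₀)
  let w₂ : Fin N → ℝ × EuclideanSpace ℝ (Fin N) → ℝ := fun k p =>
    trunc₂ a (ℓ p) * zb k p ^ 2 + trunc₁ a (ℓ p) * bb k p
  have cw₂ : ∀ k, ContinuousOn (w₂ k) (Ici t₀ ×ˢ univ) := fun k =>
    (ct₂.mul ((czb k).pow 2)).add (ct₁.mul (cbb k))
  have hw₂s : ∀ k, ∀ y ∉ K, w₂ k (t, y) = 0 := fun k y hy => by
    simp only [w₂, hts₁ t htI y hy, hts₂ t htI y hy, zero_mul, add_zero]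
  have hibp : ∀ k, ∫ y, v (t, y) * w₂ k (t, y) = ∫ y, v₂ k (t, y) * trunc a (ℓ (t, y)) := by
    intro k
    have e1 : ∀ y, HasLineDerivAt ℝ (fun y => v (t, y)) (v₁ k (t, y)) y (flow B (-t) (d k)) :=
      fun y => hasLineDerivAt_comp_flow hu B t (d k) y
    have e2 : ∀ y, HasLineDerivAt ℝ (fun y => v₁ k (t, y)) (v₂ k (t, y)) y
        (flow B (-t) (d k)) :=
      fun y => hasLineDerivAt_comp_flow (contDiff_dirDeriv hu (d k)) B t (d k) y
    have e3 : ∀ y, HasLineDerivAt ℝ (fun y => trunc a (ℓ (t, y)))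
        (trunc₁ a (ℓ (t, y)) * zb k (t, y)) y (flow B (-t) (d k)) :=
      fun y => hasLineDerivAt_trunc_logG a hpos x y _
    have e4 : ∀ y, HasLineDerivAt ℝ (fun y => trunc₁ a (ℓ (t, y)) * zb k (t, y))
        (w₂ k (t, y)) y (flow B (-t) (d k)) := by
      intro y
      have h := hasLineDerivAt_trunc₁_logG a hpos x y (flow B (-t) (d k))
      simp only [w₂, zb, bb, ℓ]
      exact h
    have g1 : Continuous fun y => v (t, y) := sl cv.continuousOn
    have g2 : Continuous fun y => v₁ k (t, y) := sl (cv₁ k).continuousOn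
    have g3 : Continuous fun y => v₂ k (t, y) := sl (cv₂ k).continuousOn
    have g4 : Continuous fun y => trunc a (ℓ (t, y)) := sl ct
    have g5 : Continuous fun y => trunc₁ a (ℓ (t, y)) * zb k (t, y) := sl (ct₁.mul (czb k))
    have g6 : Continuous fun y => w₂ k (t, y) := sl (cw₂ k)
    have z1 : ∀ y ∉ K, trunc₁ a (ℓ (t, y)) * zb k (t, y) = 0 := fun y hy => by
      rw [hts₁ t htI y hy, zero_mul]
    exact integral_mul_lineDeriv_two hKc e1 e2 e3 e4 g1 g2 g3 g4 g5 g6 (hts t htI) z1 (hw₂s k)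
  have hGeq : ∀ y, G (t, y) = ∑ k, (v (t, y) * w₂ k (t, y) - v₂ k (t, y) * trunc a (ℓ (t, y))) -
      v (t, y) * ((trunc₂ a (ℓ (t, y)) - trunc₁ a (ℓ (t, y))) *
        gradSq A B P d t₀ t (y - x)) := by
    intro y
    have hgs : gradSq A B P d t₀ t (y - x) = ∑ k, zb k (t, y) ^ 2 := rfl
    simp only [G, w₂, hgs, Finset.sum_sub_distrib, ← Finset.mul_sum, ← Finset.sum_mul,
      Finset.sum_add_distrib]
    ring
  have i1 : ∀ k, Integrable fun y => v (t, y) * w₂ k (t, y) := fun k =>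
    cpt (sl (cv.continuousOn.mul (cw₂ k))) fun y hy => by rw [hw₂s k y hy, mul_zero]
  have i2 : ∀ k, Integrable fun y => v₂ k (t, y) * trunc a (ℓ (t, y)) := fun k =>
    cpt (sl ((cv₂ k).continuousOn.mul ct)) fun y hy => by rw [hts t htI y hy, mul_zero]
  have i3 : Integrable fun y => v (t, y) * ((trunc₂ a (ℓ (t, y)) - trunc₁ a (ℓ (t, y))) *
      gradSq A B P d t₀ t (y - x)) := by
    refine cpt (sl (F := fun p => v p * ((trunc₂ a (ℓ p) - trunc₁ a (ℓ p)) * ∑ k, zb k p ^ 2))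
      (cv.continuousOn.mul ((ct₂.sub ct₁).mul
        (continuousOn_finsetSum _ fun k _ => (czb k).pow 2)))) fun y hy => ?_
    rw [hts₁ t htI y hy, hts₂ t htI y hy, sub_zero, zero_mul, mul_zero]
  have i12 : ∀ k, Integrable fun y => v (t, y) * w₂ k (t, y) - v₂ k (t, y) * trunc a (ℓ (t, y)) :=
    fun k => (i1 k).sub (i2 k)
  calc ∫ y, G (t, y) = ∫ y, (∑ k, (v (t, y) * w₂ k (t, y) - v₂ k (t, y) * trunc a (ℓ (t, y))) -
      v (t, y) * ((trunc₂ a (ℓ (t, y)) - trunc₁ a (ℓ (t, y))) *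
        gradSq A B P d t₀ t (y - x))) := integral_congr_ae (Eventually.of_forall hGeq)
    _ = ∑ k, ((∫ y, v (t, y) * w₂ k (t, y)) - ∫ y, v₂ k (t, y) * trunc a (ℓ (t, y))) -
        dissipation A B P d u x a t₀ t := by
      rw [integral_sub (integrable_finsetSum _ fun k _ => i12 k) i3,
        integral_finsetSum _ fun k _ => i12 k]
      congr 1
      exact Finset.sum_congr rfl fun k _ => integral_sub (i1 k) (i2 k)
    _ = -dissipation A B P d u x a t₀ t := by
      rw [Finset.sum_eq_zero fun k _ => by rw [hibp k, sub_self], zero_sub]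

lemma dissipation_nonneg {A B P : Matrix (Fin N) (Fin N) ℝ}
    {d : Fin N → EuclideanSpace ℝ (Fin N)} {u : EuclideanSpace ℝ (Fin N) → ℝ} (h0 : ∀ x, 0 ≤ u x)
    (x : EuclideanSpace ℝ (Fin N)) (a t₀ t : ℝ) : 0 ≤ dissipation A B P d u x a t₀ t :=
  integral_nonneg fun _ => mul_nonneg (h0 _)
    (mul_nonneg (trunc₂_sub_trunc₁_nonneg _ _) (gradSq_nonneg _ _ _ _ _ _ _))

lemma mass_le_mass {A B P : Matrix (Fin N) (Fin N) ℝ}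
    {u : EuclideanSpace ℝ (Fin N) → ℝ} (hA : A.PosSemidef) (hu : ContDiff ℝ ∞ u)
    (hL : ∀ x, L A B u x = 0) (h0 : ∀ x, 0 ≤ u x)
    (hC : ∀ t : ℝ, 0 < t → (C A B t).PosDef) (hP : P.PosDef)
    (x : EuclideanSpace ℝ (Fin N)) {a : ℝ} (ha : 0 < a) {t₀ T : ℝ} (hT : t₀ ≤ T) :
    mass A B P u x a t₀ T ≤ mass A B P u x a t₀ t₀ := by
  obtain ⟨d, hd⟩ := exists_eq_sum_vecMulVec hA
  have hder := fun t (ht : t ∈ interior (Icc t₀ T)) =>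
    hasDerivAt_mass hd hu hL hC hP x ha (interior_Icc (a := t₀) (b := T) ▸ ht).1
  have hanti : AntitoneOn (mass A B P u x a t₀) (Icc t₀ T) := by
    refine antitoneOn_of_deriv_nonpos (convex_Icc t₀ T)
      (continuousOn_mass hC hP hu.continuous x ha t₀ T)
      (fun t ht => (hder t ht).differentiableAt.differentiableWithinAt) fun t ht => ?_
    rw [(hder t ht).deriv]
    exact neg_nonpos.2 (dissipation_nonneg h0 x a t₀ t)
  exact hanti ⟨le_rfl, hT⟩ ⟨hT, le_rfl⟩ hT

/-- A bound on the dissipation bounds the loss of truncated mass. -/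
lemma mass_sub_mass_le {A B P : Matrix (Fin N) (Fin N) ℝ}
    {d : Fin N → EuclideanSpace ℝ (Fin N)} (hd : A = ∑ k, vecMulVec (d k).ofLp (d k).ofLp)
    {u : EuclideanSpace ℝ (Fin N) → ℝ} (hu : ContDiff ℝ ∞ u)
    (hL : ∀ x, L A B u x = 0)
    (hC : ∀ t : ℝ, 0 < t → (C A B t).PosDef) (hP : P.PosDef)
    (x : EuclideanSpace ℝ (Fin N)) {a : ℝ} (ha : 0 < a) {t₀ T : ℝ} (hT : t₀ ≤ T) {κ : ℝ}
    (hκ : ∀ t ∈ Ioo t₀ T, dissipation A B P d u x a t₀ t ≤ κ) :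
    mass A B P u x a t₀ t₀ - mass A B P u x a t₀ T ≤ κ * (T - t₀) := by
  have hder := fun t (ht : t ∈ interior (Icc t₀ T)) =>
    hasDerivAt_mass hd hu hL hC hP x ha (interior_Icc (a := t₀) (b := T) ▸ ht).1
  have := (convex_Icc t₀ T).mul_sub_le_image_sub_of_le_deriv (C := -κ)
    (continuousOn_mass hC hP hu.continuous x ha t₀ T)
    (fun t ht => (hder t ht).differentiableAt.differentiableWithinAt)
    (fun t ht => by
      rw [(hder t ht).deriv]
      exact neg_le_neg (hκ t (interior_Icc (a := t₀) (b := T) ▸ ht)))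
    t₀ ⟨le_rfl, hT⟩ T ⟨hT, le_rfl⟩ hT
  linarith

end Mass

/-! ### Isotropic Gaussians -/

section IsotropicGaussian

variable {N : ℕ}

/-- The total mass `(4π)^(N/2)` of the Gaussians `exp (logG S)`. -/
noncomputable def gaussMass (N : ℕ) : ℝ := (4 * Real.pi) ^ ((N : ℝ) / 2)

lemma gaussMass_pos (N : ℕ) : 0 < gaussMass N := by unfold gaussMass; positivity

lemma smul_one_posDef {η : ℝ} (hη : 0 < η) : (η • (1 : Matrix (Fin N) (Fin N) ℝ)).PosDef :=
  PosDef.one.smul hη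

lemma exp_logG_smul_one {η : ℝ} (hη : 0 < η) (z : EuclideanSpace ℝ (Fin N)) :
    Real.exp (logG (η • (1 : Matrix (Fin N) (Fin N) ℝ)) z) =
      η ^ (-((N : ℝ) / 2)) * Real.exp (-(1 / (4 * η)) * ‖z‖ ^ 2) := by
  have hinv : (η • (1 : Matrix (Fin N) (Fin N) ℝ))⁻¹ = η⁻¹ • (1 : Matrix (Fin N) (Fin N) ℝ) := by
    refine inv_eq_right_inv ?_
    rw [smul_mul_smul_comm, mul_inv_cancel₀ hη.ne', one_mul, one_smul]
  rw [logG, hinv, bil_smul, bil_one, real_inner_self_eq_norm_sq, det_smul, det_one, mul_one,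
    Fintype.card_fin, Real.log_pow, Real.rpow_def_of_pos hη, ← Real.exp_add]
  congr 1
  field_simp
  ring

lemma integrable_exp_logG_smul_one {η : ℝ} (hη : 0 < η) (x : EuclideanSpace ℝ (Fin N)) :
    Integrable fun y => Real.exp (logG (η • (1 : Matrix (Fin N) (Fin N) ℝ)) (y - x)) := by
  have h : Integrable fun z : EuclideanSpace ℝ (Fin N) =>
      Real.exp (logG (η • (1 : Matrix (Fin N) (Fin N) ℝ)) z) := by
    simp only [exp_logG_smul_one hη]
    refine Integrable.const_mul ?_ _
    by_contra hcon
    have := GaussianFourier.integral_rexp_neg_mul_sq_norm (V := EuclideanSpace ℝ (Fin N))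
      (show 0 < 1 / (4 * η) by positivity)
    rw [integral_undef hcon] at this
    have hpos : 0 < (Real.pi / (1 / (4 * η))) ^
      (Module.finrank ℝ (EuclideanSpace ℝ (Fin N)) / 2 : ℝ) := by positivity
    linarith
  exact h.comp_sub_right x

lemma integral_exp_logG_smul_one {η : ℝ} (hη : 0 < η) (x : EuclideanSpace ℝ (Fin N)) :
    ∫ y, Real.exp (logG (η • (1 : Matrix (Fin N) (Fin N) ℝ)) (y - x)) = gaussMass N := by
  rw [integral_sub_right_eq_self
    (fun y => Real.exp (logG (η • (1 : Matrix (Fin N) (Fin N) ℝ)) y)) x]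
  simp only [exp_logG_smul_one hη]
  rw [integral_const_mul, GaussianFourier.integral_rexp_neg_mul_sq_norm (by positivity),
    finrank_euclideanSpace_fin, gaussMass,
    show Real.pi / (1 / (4 * η)) = η * (4 * Real.pi) by field_simp,
    Real.mul_rpow hη.le (by positivity), ← mul_assoc, ← Real.rpow_add hη, neg_add_cancel,
    Real.rpow_zero, one_mul]

/-- Away from the centre, the isotropic Gaussians tend to zero uniformly. -/
lemma eventually_exp_logG_smul_one_le {r a : ℝ} (hr : 0 < r) (ha : 0 < a) :
    ∀ᶠ η : ℝ in 𝓝[>] 0, ∀ z : EuclideanSpace ℝ (Fin N), r ≤ ‖z‖ →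
      Real.exp (logG (η • (1 : Matrix (Fin N) (Fin N) ℝ)) z) ≤ a := by
  have h1 : Tendsto (fun s : ℝ => s ^ ((N : ℝ) / 2) * Real.exp (-(r ^ 2 / 4) * s)) atTop (𝓝 0) :=
    tendsto_rpow_mul_exp_neg_mul_atTop_nhds_zero _ _ (by positivity)
  have h2 := (h1.comp tendsto_inv_nhdsGT_zero).eventually (gt_mem_nhds ha)
  filter_upwards [h2, self_mem_nhdsWithin] with η h hη z hz
  have hη : 0 < η := hη
  rw [exp_logG_smul_one hη]
  refine le_trans ?_ h.le
  simp only [Function.comp_apply]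
  rw [Real.inv_rpow hη.le, Real.rpow_neg hη.le]
  have h3 : r ^ 2 / 4 * η⁻¹ ≤ ‖z‖ ^ 2 / 4 * η⁻¹ := by gcongr
  have h4 : -(1 / (4 * η)) * ‖z‖ ^ 2 ≤ -(r ^ 2 / 4) * η⁻¹ := by
    calc -(1 / (4 * η)) * ‖z‖ ^ 2 = -(‖z‖ ^ 2 / 4 * η⁻¹) := by field_simp
      _ ≤ -(r ^ 2 / 4) * η⁻¹ := by linarith
  exact mul_le_mul_of_nonneg_left (Real.exp_le_exp.2 h4) (by positivity)

/-- The isotropic Gaussians concentrate at their centre. -/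
lemma tendsto_setIntegral_exp_logG_smul_one {r : ℝ} (hr : 0 < r) (x : EuclideanSpace ℝ (Fin N)) :
    Tendsto (fun η : ℝ => ∫ y in Metric.ball x r,
      Real.exp (logG (η • (1 : Matrix (Fin N) (Fin N) ℝ)) (y - x))) (𝓝[>] 0)
      (𝓝 (gaussMass N)) := by
  have hlow : Tendsto (fun η : ℝ => gaussMass N -
      2 ^ ((N : ℝ) / 2) * Real.exp (-(r ^ 2 / 8) * η⁻¹) * gaussMass N) (𝓝[>] 0)
      (𝓝 (gaussMass N - 2 ^ ((N : ℝ) / 2) * 0 * gaussMass N)) := by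
    refine tendsto_const_nhds.sub ((tendsto_const_nhds.mul ?_).mul_const _)
    refine Real.tendsto_exp_atBot.comp ?_
    exact tendsto_inv_nhdsGT_zero.const_mul_atTop_of_neg (by nlinarith [sq_pos_of_pos hr])
  rw [mul_zero, zero_mul, sub_zero] at hlow
  refine tendsto_of_tendsto_of_tendsto_of_le_of_le' hlow tendsto_const_nhds ?_ ?_
  · filter_upwards [self_mem_nhdsWithin] with η hη
    have hη : 0 < η := hη
    have hi := integrable_exp_logG_smul_one (N := N) hη x
    have h2η : 0 < 2 * η := by positivity
    have hsum := integral_add_compl (Metric.isOpen_ball (x := x) (ε := r)).measurableSet hi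
    rw [integral_exp_logG_smul_one hη x] at hsum
    have hc : ∫ y in (Metric.ball x r)ᶜ,
        Real.exp (logG (η • (1 : Matrix (Fin N) (Fin N) ℝ)) (y - x)) ≤
        2 ^ ((N : ℝ) / 2) * Real.exp (-(r ^ 2 / 8) * η⁻¹) *
          ∫ y, Real.exp (logG ((2 * η) • (1 : Matrix (Fin N) (Fin N) ℝ)) (y - x)) := by
      rw [← integral_const_mul]
      have hi2 := (integrable_exp_logG_smul_one (N := N) h2η x).const_mul
        (2 ^ ((N : ℝ) / 2) * Real.exp (-(r ^ 2 / 8) * η⁻¹))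
      refine le_trans (setIntegral_mono_on hi.integrableOn hi2.integrableOn
        Metric.isOpen_ball.measurableSet.compl fun y hy => ?_)
        (setIntegral_le_integral hi2 (Eventually.of_forall fun y => by
          simp only [Pi.zero_apply]; positivity))
      rw [exp_logG_smul_one hη, exp_logG_smul_one h2η]
      have hz : r ≤ ‖y - x‖ := by
        simpa [dist_eq_norm] using hy
      rw [Real.mul_rpow (by norm_num) hη.le, Real.rpow_neg (by norm_num : (0 : ℝ) ≤ 2)]
      have h2 : (0 : ℝ) < 2 ^ ((N : ℝ) / 2) := by positivity
      have e1 : 2 ^ ((N : ℝ) / 2) * Real.exp (-(r ^ 2 / 8) * η⁻¹) *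
          ((2 ^ ((N : ℝ) / 2))⁻¹ * η ^ (-((N : ℝ) / 2)) *
            Real.exp (-(1 / (4 * (2 * η))) * ‖y - x‖ ^ 2)) =
          η ^ (-((N : ℝ) / 2)) * Real.exp (-(r ^ 2 / 8) * η⁻¹ +
            -(1 / (4 * (2 * η))) * ‖y - x‖ ^ 2) := by
        rw [Real.exp_add]; field_simp
      rw [e1]
      gcongr
      have h3 : r ^ 2 ≤ ‖y - x‖ ^ 2 := by gcongr
      have h4 : r ^ 2 / 8 * η⁻¹ ≤ ‖y - x‖ ^ 2 / 8 * η⁻¹ := by gcongr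
      have e2 : -(1 / (4 * η)) * ‖y - x‖ ^ 2 = -(‖y - x‖ ^ 2 / 8 * η⁻¹) -
        ‖y - x‖ ^ 2 / 8 * η⁻¹ := by field_simp; ring
      have e3 : -(1 / (4 * (2 * η))) * ‖y - x‖ ^ 2 = -(‖y - x‖ ^ 2 / 8 * η⁻¹) := by
        field_simp; ring
      rw [e2, e3]
      linarith
    rw [integral_exp_logG_smul_one h2η x] at hc
    linarith
  · filter_upwards [self_mem_nhdsWithin] with η hη
    have hη : 0 < η := hη
    rw [← integral_exp_logG_smul_one hη x]
    exact setIntegral_le_integral (integrable_exp_logG_smul_one hη x)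
      (Eventually.of_forall fun y => (Real.exp_pos _).le)

end IsotropicGaussian

/-! ### Gaussian averages are dominated by the function -/

section MeanValue

variable {N : ℕ}

lemma integrable_mass {A B P : Matrix (Fin N) (Fin N) ℝ} {u : EuclideanSpace ℝ (Fin N) → ℝ}
    (hC : ∀ t : ℝ, 0 < t → (C A B t).PosDef) (hP : P.PosDef) (hu : Continuous u)
    (x : EuclideanSpace ℝ (Fin N)) {a : ℝ} (ha : 0 < a) {t₀ t : ℝ} (ht : t₀ ≤ t) :
    Integrable fun y => u (flow B t y) * trunc a (logG (cov A B P t₀ t) (y - x)) := by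
  obtain ⟨ρ, hρ⟩ := exists_exp_logG_cov_le hC hP t₀ t x ha
  refine Continuous.integrable_of_hasCompactSupport ?_
    (HasCompactSupport.intro (isCompact_closedBall x ρ) fun y hy => ?_)
  · exact (hu.comp (continuous_flow_right B t)).mul
      ((continuous_trunc a).comp ((continuous_logG _).comp (continuous_id.sub continuous_const)))
  · rw [trunc_of_exp_le (hρ t ⟨ht, le_rfl⟩ y hy), mul_zero]

/-- The truncated mass started from a concentrated Gaussian is close to the value at its centre. -/
lemma eventually_mass_self_le {A B : Matrix (Fin N) (Fin N) ℝ}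
    {u : EuclideanSpace ℝ (Fin N) → ℝ} (hC : ∀ t : ℝ, 0 < t → (C A B t).PosDef)
    (hu : Continuous u) (h0 : ∀ x, 0 ≤ u x) (x : EuclideanSpace ℝ (Fin N)) {a : ℝ} (ha : 0 < a)
    (t₀ : ℝ) {c : ℝ} (hc : u (flow B t₀ x) < c) :
    ∀ᶠ η : ℝ in 𝓝[>] 0, mass A B (η • 1) u x a t₀ t₀ ≤ c * gaussMass N := by
  have hcont : Continuous fun y => u (flow B t₀ y) := hu.comp (continuous_flow_right B t₀)
  obtain ⟨r, hr, hball⟩ := Metric.mem_nhds_iff.1 (hcont.continuousAt.eventually (gt_mem_nhds hc))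
  filter_upwards [eventually_exp_logG_smul_one_le (N := N) hr ha, self_mem_nhdsWithin]
    with η hη hpos
  have hpos : 0 < η := hpos
  rw [mass, ← integral_exp_logG_smul_one hpos x, ← integral_const_mul]
  refine integral_mono (integrable_mass hC (smul_one_posDef hpos) hu x ha le_rfl)
    ((integrable_exp_logG_smul_one hpos x).const_mul c) fun y => ?_
  simp only [cov_self]
  have hc0 : 0 ≤ c := (h0 _).trans hc.le
  by_cases hy : y ∈ Metric.ball x r
  · have h1 : u (flow B t₀ y) < c := hball hy
    gcongr
    · exact trunc_nonneg _ _
    · exact trunc_le_exp ha.le _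
  · have h1 : r ≤ ‖y - x‖ := by
      simpa [dist_eq_norm] using hy
    rw [trunc_of_exp_le (hη _ h1), mul_zero]
    positivity

/-- Fatou's lemma along a pointwise convergent sequence. -/
lemma lintegral_le_of_tendsto {α : Type*} [MeasurableSpace α] {μ : Measure α}
    {f : ℕ → α → ENNReal} {g : α → ENNReal} {c : ENNReal} (hf : ∀ n, Measurable (f n))
    (hlim : ∀ y, Tendsto (fun n => f n y) atTop (𝓝 (g y)))
    (hc : ∀ᶠ n in atTop, ∫⁻ y, f n y ∂μ ≤ c) : ∫⁻ y, g y ∂μ ≤ c := by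
  calc ∫⁻ y, g y ∂μ = ∫⁻ y, liminf (fun n => f n y) atTop ∂μ :=
        lintegral_congr fun y => (hlim y).liminf_eq.symm
    _ ≤ liminf (fun n => ∫⁻ y, f n y ∂μ) atTop := lintegral_liminf_le hf
    _ ≤ c := liminf_le_of_frequently_le' hc.frequently

lemma continuousAt_logG {S : Matrix (Fin N) (Fin N) ℝ} (hS : S.det ≠ 0)
    (z : EuclideanSpace ℝ (Fin N)) : ContinuousAt (fun S => logG S z) S := by
  have h1 : ContinuousAt (fun S : Matrix (Fin N) (Fin N) ℝ => Real.log S.det) S :=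
    continuous_id.matrix_det.continuousAt.log hS
  have h2 : ContinuousAt (fun S : Matrix (Fin N) (Fin N) ℝ => bil S⁻¹ z z) S := by
    have h3 : Continuous fun M : Matrix (Fin N) (Fin N) ℝ => bil M z z :=
      continuous_id.bil continuous_const continuous_const
    exact h3.continuousAt.comp (continuousAt_matrix_inv hS)
  exact (continuousAt_const.mul h1).sub (continuousAt_const.mul h2)

lemma tendsto_trunc (r : ℝ) : Tendsto (fun a => trunc a r) (𝓝[>] 0) (𝓝 (Real.exp r)) := by
  have h : Tendsto (fun a : ℝ => Real.exp r - 3 * a) (𝓝[>] 0) (𝓝 (Real.exp r - 3 * 0)) :=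
    tendsto_const_nhds.sub ((tendsto_nhdsWithin_of_tendsto_nhds tendsto_id).const_mul 3)
  rw [mul_zero, sub_zero] at h
  refine tendsto_of_tendsto_of_tendsto_of_le_of_le' h tendsto_const_nhds ?_ ?_
  · filter_upwards [self_mem_nhdsWithin] with a ha
    exact exp_sub_le_trunc (le_of_lt ha) r
  · filter_upwards [self_mem_nhdsWithin] with a ha
    exact trunc_le_exp (le_of_lt ha) r

lemma exists_seq_tendsto_nhdsGT_zero : ∃ s : ℕ → ℝ, Tendsto s atTop (𝓝[>] 0) ∧ ∀ n, 0 < s n :=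
  ⟨fun n => 1 / ((n : ℝ) + 1), tendsto_nhdsWithin_iff.2 ⟨tendsto_one_div_add_atTop_nhds_zero_nat,
    Eventually.of_forall fun n => by simp only [mem_Ioi]; positivity⟩, fun n => by positivity⟩

/-- Nonnegative `ℒ`-harmonic functions dominate their Gaussian averages. -/
theorem lintegral_gaussian_le {A B : Matrix (Fin N) (Fin N) ℝ}
    {u : EuclideanSpace ℝ (Fin N) → ℝ} (hA : A.PosSemidef) (hu : ContDiff ℝ ∞ u)
    (hL : ∀ x, L A B u x = 0) (h0 : ∀ x, 0 ≤ u x)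
    (hC : ∀ t : ℝ, 0 < t → (C A B t).PosDef) (x : EuclideanSpace ℝ (Fin N)) {t₀ T : ℝ}
    (hT : t₀ < T) :
    ∫⁻ y, ENNReal.ofReal (u (flow B T y) * Real.exp (logG (C A B T - C A B t₀) (y - x))) ≤
      ENNReal.ofReal (u (flow B t₀ x) * gaussMass N) := by
  obtain ⟨s, hs, hspos⟩ := exists_seq_tendsto_nhdsGT_zero
  have hdet := (C_sub_posDef hC hT).det_pos.ne'
  have cu : Continuous fun y => u (flow B T y) := hu.continuous.comp (continuous_flow_right B T)
  have cg : ∀ S : Matrix (Fin N) (Fin N) ℝ, Continuous fun y => logG S (y - x) := fun S =>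
    (continuous_logG S).comp (continuous_id.sub continuous_const)
  -- remove the initial spread, for a fixed truncation
  have h1 : ∀ a > 0, ∫⁻ y, ENNReal.ofReal (u (flow B T y) *
      trunc a (logG (C A B T - C A B t₀) (y - x))) ≤
      ENNReal.ofReal (u (flow B t₀ x) * gaussMass N) := by
    intro a ha
    have h2 : ∀ c, u (flow B t₀ x) < c → ∫⁻ y, ENNReal.ofReal (u (flow B T y) *
        trunc a (logG (C A B T - C A B t₀) (y - x))) ≤ ENNReal.ofReal (c * gaussMass N) := by
      intro c hc
      refine lintegral_le_of_tendsto (f := fun n y => ENNReal.ofReal (u (flow B T y) *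
        trunc a (logG (cov A B (s n • 1) t₀ T) (y - x)))) (fun n => ?_) (fun y => ?_) ?_
      · exact (cu.mul ((continuous_trunc a).comp (cg _))).measurable.ennreal_ofReal
      · refine (ENNReal.continuous_ofReal.tendsto _).comp (tendsto_const_nhds.mul ?_)
        refine ((continuous_trunc a).tendsto _).comp ?_
        refine (continuousAt_logG hdet (y - x)).tendsto.comp ?_
        have h3 : Tendsto (fun n => s n • (1 : Matrix (Fin N) (Fin N) ℝ) +
            (C A B T - C A B t₀)) atTop
            (𝓝 ((0 : ℝ) • (1 : Matrix (Fin N) (Fin N) ℝ) + (C A B T - C A B t₀))) :=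
          ((tendsto_nhds_of_tendsto_nhdsWithin hs).smul_const _).add_const _
        rw [zero_smul, zero_add] at h3
        exact h3
      · filter_upwards [hs.eventually (eventually_mass_self_le hC hu.continuous h0 x ha t₀ hc)]
          with n hn
        have hP := smul_one_posDef (N := N) (hspos n)
        rw [← ofReal_integral_eq_lintegral_ofReal
          (integrable_mass hC hP hu.continuous x ha hT.le)
          (Eventually.of_forall fun y => mul_nonneg (h0 _) (trunc_nonneg _ _))]
        exact ENNReal.ofReal_le_ofReal ((mass_le_mass hA hu hL h0 hC hP x ha hT.le).trans hn)
    have h3 : Tendsto (fun c : ℝ => ENNReal.ofReal (c * gaussMass N)) (𝓝[>] (u (flow B t₀ x)))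
        (𝓝 (ENNReal.ofReal (u (flow B t₀ x) * gaussMass N))) :=
      (ENNReal.continuous_ofReal.tendsto _).comp
        ((tendsto_nhdsWithin_of_tendsto_nhds tendsto_id).mul_const _)
    refine ge_of_tendsto h3 ?_
    filter_upwards [self_mem_nhdsWithin] with c hc using h2 c hc
  -- remove the truncation
  refine lintegral_le_of_tendsto (f := fun n y => ENNReal.ofReal (u (flow B T y) *
    trunc (s n) (logG (C A B T - C A B t₀) (y - x)))) (fun n => ?_) (fun y => ?_)
    (Eventually.of_forall fun n => h1 (s n) (hspos n))
  · exact (cu.mul ((continuous_trunc _).comp (cg _))).measurable.ennreal_ofReal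
  · exact (ENNReal.continuous_ofReal.tendsto _).comp
      (tendsto_const_nhds.mul ((tendsto_trunc _).comp hs))

end MeanValue

/-! ### Growth bounds and the reverse mean value inequality -/

section Growth

variable {N : ℕ}

/-- A nonnegative `ℒ`-harmonic function has finite integrals against all Gaussians, uniformly on
bounded time intervals, provided the past covariance exhausts all directions. -/
theorem exists_integral_exp_neg_le {A B : Matrix (Fin N) (Fin N) ℝ}
    {u : EuclideanSpace ℝ (Fin N) → ℝ} (hA : A.PosSemidef) (hu : ContDiff ℝ ∞ u)
    (hL : ∀ x, L A B u x = 0) (h0 : ∀ x, 0 ≤ u x)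
    (hC : ∀ t : ℝ, 0 < t → (C A B t).PosDef)
    (hK : ∀ l : ℝ, ∀ᶠ h in atTop, ∀ z, l * ‖z‖ ^ 2 ≤ bil (-C A B (-h)) z z)
    {ε : ℝ} (hε : 0 < ε) (T : ℝ) :
    ∃ κ, ∀ t ∈ Icc 0 T, Integrable (fun y => u (flow B t y) * Real.exp (-ε * ‖y‖ ^ 2)) ∧
      ∫ y, u (flow B t y) * Real.exp (-ε * ‖y‖ ^ 2) ≤ κ := by
  -- start at a time `-h` so remote that the Gaussian centred at `0` decays more slowly than
  -- `exp (-ε |y|²)`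
  obtain ⟨h, hh, hpos⟩ := ((hK (1 / (4 * ε))).and (eventually_gt_atTop 0)).exists
  have hΓ : ∀ t ∈ Icc 0 T, (C A B t - C A B (-h)).PosDef := fun t ht =>
    C_sub_posDef hC (by linarith [ht.1])
  have hcov : (fun t => C A B t - C A B (-h)) = cov A B 0 (-h) := by
    funext t; simp [cov]
  have hcont : ContinuousOn (fun t => -(1 / 2) * Real.log (C A B t - C A B (-h)).det)
      (Icc 0 T) := by
    have h1 : Continuous fun t => C A B t - C A B (-h) := hcov ▸ continuous_cov A B 0 (-h)
    exact continuousOn_const.mul (h1.matrix_det.continuousOn.log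
      fun t ht => (hΓ t ht).det_pos.ne')
  obtain ⟨m, hm⟩ := isCompact_Icc.bddBelow_image hcont
  have hflow0 : u (flow B (-h) 0) = u 0 := by simp [flow]
  refine ⟨Real.exp (-m) * (u 0 * gaussMass N), fun t ht => ?_⟩
  have hm := hm (mem_image_of_mem _ ht)
  have hbil : ∀ z, 1 / (4 * ε) * ‖z‖ ^ 2 ≤ bil (C A B t - C A B (-h)) z z := by
    intro z
    have h1 := hh z
    have h2 := bil_nonneg (C_posSemidef hC ht.1) z
    rw [sub_eq_add_neg, bil_add]
    linarith
  have hlog : ∀ y, -ε * ‖y‖ ^ 2 ≤ -m + logG (C A B t - C A B (-h)) (y - 0) := by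
    intro y
    have h1 := bil_inv_le_norm_sq_div (hΓ t ht) (by positivity) hbil y
    have h2 : ‖y‖ ^ 2 / (1 / (4 * ε)) = 4 * (ε * ‖y‖ ^ 2) := by field_simp
    rw [h2] at h1
    rw [sub_zero, logG]
    linarith
  have cv : Continuous fun y => u (flow B t y) := hu.continuous.comp (continuous_flow_right B t)
  have hlin : ∫⁻ y, ENNReal.ofReal (u (flow B t y) * Real.exp (-ε * ‖y‖ ^ 2)) ≤
      ENNReal.ofReal (Real.exp (-m) * (u 0 * gaussMass N)) := by
    calc ∫⁻ y, ENNReal.ofReal (u (flow B t y) * Real.exp (-ε * ‖y‖ ^ 2))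
        ≤ ∫⁻ y, ENNReal.ofReal (Real.exp (-m)) * ENNReal.ofReal (u (flow B t y) *
            Real.exp (logG (C A B t - C A B (-h)) (y - 0))) := by
          refine lintegral_mono fun y => ?_
          rw [← ENNReal.ofReal_mul (Real.exp_pos _).le]
          refine ENNReal.ofReal_le_ofReal ?_
          calc u (flow B t y) * Real.exp (-ε * ‖y‖ ^ 2)
              ≤ u (flow B t y) * Real.exp (-m + logG (C A B t - C A B (-h)) (y - 0)) :=
                mul_le_mul_of_nonneg_left (Real.exp_le_exp.2 (hlog y)) (h0 _)
            _ = _ := by rw [Real.exp_add]; ring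
      _ = ENNReal.ofReal (Real.exp (-m)) * ∫⁻ y, ENNReal.ofReal (u (flow B t y) *
            Real.exp (logG (C A B t - C A B (-h)) (y - 0))) :=
          lintegral_const_mul' _ _ ENNReal.ofReal_ne_top
      _ ≤ ENNReal.ofReal (Real.exp (-m)) * ENNReal.ofReal (u (flow B (-h) 0) * gaussMass N) := by
          gcongr
          exact lintegral_gaussian_le hA hu hL h0 hC 0 (by linarith [ht.1])
      _ = _ := by rw [hflow0, ENNReal.ofReal_mul (Real.exp_pos _).le]
  have hnn : ∀ y, 0 ≤ u (flow B t y) * Real.exp (-ε * ‖y‖ ^ 2) := fun y =>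
    mul_nonneg (h0 _) (Real.exp_pos _).le
  have hcm : Continuous fun y => u (flow B t y) * Real.exp (-ε * ‖y‖ ^ 2) :=
    cv.mul (by fun_prop)
  refine ⟨(lintegral_ofReal_ne_top_iff_integrable hcm.aestronglyMeasurable
    (Eventually.of_forall hnn)).1 (ne_top_of_le_ne_top ENNReal.ofReal_ne_top hlin), ?_⟩
  rw [integral_eq_lintegral_of_nonneg_ae (Eventually.of_forall hnn) hcm.aestronglyMeasurable]
  refine ENNReal.toReal_le_of_le_ofReal ?_ hlin
  exact mul_nonneg (Real.exp_pos _).le (mul_nonneg (h0 _) (gaussMass_pos N).le)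

open scoped Matrix.Norms.L2Operator in
lemma exists_gradSq_le {A B P : Matrix (Fin N) (Fin N) ℝ}
    (d : Fin N → EuclideanSpace ℝ (Fin N)) (hC : ∀ t : ℝ, 0 < t → (C A B t).PosDef)
    (hP : P.PosDef) (t₀ T : ℝ) :
    ∃ M, 0 ≤ M ∧ ∀ t ∈ Icc t₀ T, ∀ z, gradSq A B P d t₀ t z ≤ M * ‖z‖ ^ 2 := by
  have hcont : ContinuousOn (fun t => ∑ k, (‖(cov A B P t₀ t)⁻¹‖ * ‖flow B (-t) (d k)‖) ^ 2)
      (Icc t₀ T) := by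
    refine continuousOn_finsetSum _ fun k _ => (ContinuousOn.mul ?_ ?_).pow 2
    · exact fun t ht => (hasDerivAt_inv_matrix (hasDerivAt_cov A B P t₀ t)
        (cov_posDef hC hP ht.1).det_pos.ne').continuousAt.norm.continuousWithinAt
    · exact ((continuous_flow B).comp (continuous_neg.prodMk continuous_const)).norm.continuousOn
  obtain ⟨M, hM⟩ := isCompact_Icc.bddAbove_image hcont
  refine ⟨|M|, abs_nonneg M, fun t ht z => ?_⟩
  have h1 := (hM (mem_image_of_mem _ ht)).trans (le_abs_self M)
  refine le_trans ?_ (mul_le_mul_of_nonneg_right h1 (sq_nonneg ‖z‖))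
  rw [gradSq, Finset.sum_mul]
  refine Finset.sum_le_sum fun k _ => ?_
  have h2 := abs_bil_le (cov A B P t₀ t)⁻¹ z (flow B (-t) (d k))
  have h3 := pow_le_pow_left₀ (abs_nonneg _) h2 2
  rw [sq_abs] at h3
  nlinarith [sq_nonneg (bil (cov A B P t₀ t)⁻¹ z (flow B (-t) (d k)))]

lemma neg_mul_norm_sub_sq_le {δ : ℝ} (hδ : 0 ≤ δ) (x y : EuclideanSpace ℝ (Fin N)) :
    -(δ * ‖y - x‖ ^ 2) ≤ δ * ‖x‖ ^ 2 + -(δ / 2) * ‖y‖ ^ 2 := by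
  have h1 : ‖y‖ ≤ ‖y - x‖ + ‖x‖ := by simpa using norm_add_le (y - x) x
  have h2 : ‖y‖ ^ 2 ≤ 2 * ‖y - x‖ ^ 2 + 2 * ‖x‖ ^ 2 := by
    nlinarith [norm_nonneg y, sq_nonneg (‖y - x‖ - ‖x‖)]
  nlinarith

/-- The dissipation is of order `√a`, uniformly on bounded time intervals. -/
lemma exists_dissipation_le {A B P : Matrix (Fin N) (Fin N) ℝ}
    (d : Fin N → EuclideanSpace ℝ (Fin N)) {u : EuclideanSpace ℝ (Fin N) → ℝ}
    (h0 : ∀ x, 0 ≤ u x) (hC : ∀ t : ℝ, 0 < t → (C A B t).PosDef) (hP : P.PosDef) {T : ℝ}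
    (hgrowth : ∀ ε > 0, ∃ κ, ∀ t ∈ Icc 0 T,
      Integrable (fun y => u (flow B t y) * Real.exp (-ε * ‖y‖ ^ 2)) ∧
      ∫ y, u (flow B t y) * Real.exp (-ε * ‖y‖ ^ 2) ≤ κ)
    (x : EuclideanSpace ℝ (Fin N)) :
    ∃ κ, ∀ a > 0, ∀ t ∈ Icc 0 T, dissipation A B P d u x a 0 t ≤ κ * √a := by
  obtain ⟨δ, hδ, D, hD⟩ := exists_logG_cov_le hC hP 0 T
  obtain ⟨M, hM0, hM⟩ := exists_gradSq_le d hC hP 0 T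
  -- of the decay `exp (-δ/2 |y - x|²)` left by the truncation, one half absorbs the gradient and
  -- the other one, recentred at the origin, is `exp (-δ/8 |y|²)`
  obtain ⟨κ, hκ⟩ := hgrowth (δ / 4 / 2) (by positivity)
  set Q := 6 * Real.exp (D / 2) * (M * (4 / δ)) * Real.exp (δ / 4 * ‖x‖ ^ 2) with hQ
  have hQ0 : 0 ≤ Q := by positivity
  refine ⟨Q * κ, fun a ha t ht => ?_⟩
  have hpt : ∀ y, u (flow B t y) * ((trunc₂ a (logG (cov A B P 0 t) (y - x)) -
      trunc₁ a (logG (cov A B P 0 t) (y - x))) * gradSq A B P d 0 t (y - x)) ≤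
      (Q * √a) * (u (flow B t y) * Real.exp (-(δ / 4 / 2) * ‖y‖ ^ 2)) := by
    intro y
    set z := y - x with hz
    have e1 : trunc₂ a (logG (cov A B P 0 t) z) - trunc₁ a (logG (cov A B P 0 t) z) ≤
        6 * √a * (Real.exp (D / 2) * (Real.exp (-(δ / 4 * ‖z‖ ^ 2)) *
          Real.exp (-(δ / 4 * ‖z‖ ^ 2)))) := by
      refine (trunc₂_sub_trunc₁_le ha _).trans ?_
      refine mul_le_mul_of_nonneg_left ?_ (by positivity)
      rw [← Real.exp_add, ← Real.exp_add]
      have := hD t ht z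
      exact Real.exp_le_exp.2 (by linarith)
    have e2 : gradSq A B P d 0 t z ≤ M * (4 / δ) * Real.exp (δ / 4 * ‖z‖ ^ 2) := by
      refine (hM t ht z).trans ?_
      rw [mul_assoc]
      refine mul_le_mul_of_nonneg_left ?_ hM0
      have := Real.add_one_le_exp (δ / 4 * ‖z‖ ^ 2)
      calc ‖z‖ ^ 2 = 4 / δ * (δ / 4 * ‖z‖ ^ 2) := by field_simp
        _ ≤ 4 / δ * Real.exp (δ / 4 * ‖z‖ ^ 2) := by gcongr; linarith
    have e3 : Real.exp (-(δ / 4 * ‖z‖ ^ 2)) ≤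
        Real.exp (δ / 4 * ‖x‖ ^ 2) * Real.exp (-(δ / 4 / 2) * ‖y‖ ^ 2) := by
      rw [← Real.exp_add]
      exact Real.exp_le_exp.2 (neg_mul_norm_sub_sq_le (by positivity) x y)
    have e4 : Real.exp (-(δ / 4 * ‖z‖ ^ 2)) * Real.exp (δ / 4 * ‖z‖ ^ 2) = 1 := by
      rw [← Real.exp_add, neg_add_cancel, Real.exp_zero]
    have e5 := mul_le_mul e1 e2 (gradSq_nonneg _ _ _ _ _ _ _) (by positivity)
    calc _ ≤ u (flow B t y) * (6 * √a * Real.exp (D / 2) * (M * (4 / δ)) *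
          Real.exp (-(δ / 4 * ‖z‖ ^ 2))) := by
          refine mul_le_mul_of_nonneg_left (e5.trans (le_of_eq ?_)) (h0 _)
          linear_combination (6 * √a * Real.exp (D / 2) * (M * (4 / δ)) *
            Real.exp (-(δ / 4 * ‖z‖ ^ 2))) * e4
      _ ≤ u (flow B t y) * (6 * √a * Real.exp (D / 2) * (M * (4 / δ)) *
          (Real.exp (δ / 4 * ‖x‖ ^ 2) * Real.exp (-(δ / 4 / 2) * ‖y‖ ^ 2))) := by
          refine mul_le_mul_of_nonneg_left (mul_le_mul_of_nonneg_left e3 (by positivity)) (h0 _)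
      _ = _ := by rw [hQ]; ring
  calc dissipation A B P d u x a 0 t
      ≤ ∫ y, (Q * √a) * (u (flow B t y) * Real.exp (-(δ / 4 / 2) * ‖y‖ ^ 2)) := by
        refine integral_mono_of_nonneg (Eventually.of_forall fun y => ?_)
          ((hκ t ht).1.const_mul _) (Eventually.of_forall hpt)
        exact mul_nonneg (h0 _)
          (mul_nonneg (trunc₂_sub_trunc₁_nonneg _ _) (gradSq_nonneg _ _ _ _ _ _ _))
    _ = (Q * √a) * ∫ y, u (flow B t y) * Real.exp (-(δ / 4 / 2) * ‖y‖ ^ 2) :=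
        integral_const_mul _ _
    _ ≤ (Q * √a) * κ := by
        gcongr
        exact (hκ t ht).2
    _ = Q * κ * √a := by ring

lemma integrable_mul_exp_logG_cov {A B P : Matrix (Fin N) (Fin N) ℝ}
    {u : EuclideanSpace ℝ (Fin N) → ℝ} (hu : Continuous u)
    (h0 : ∀ x, 0 ≤ u x) (hC : ∀ t : ℝ, 0 < t → (C A B t).PosDef) (hP : P.PosDef) {T : ℝ}
    (hT : 0 ≤ T)
    (hgrowth : ∀ ε > 0, ∃ κ, ∀ t ∈ Icc 0 T,
      Integrable (fun y => u (flow B t y) * Real.exp (-ε * ‖y‖ ^ 2)) ∧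
      ∫ y, u (flow B t y) * Real.exp (-ε * ‖y‖ ^ 2) ≤ κ)
    (x : EuclideanSpace ℝ (Fin N)) :
    Integrable fun y => u (flow B T y) * Real.exp (logG (cov A B P 0 T) (y - x)) := by
  obtain ⟨δ, hδ, D, hD⟩ := exists_logG_cov_le hC hP 0 T
  obtain ⟨κ, hκ⟩ := hgrowth (δ / 2) (by positivity)
  have hTI : T ∈ Icc 0 T := ⟨hT, le_rfl⟩
  refine ((hκ T hTI).1.const_mul (Real.exp (D + δ * ‖x‖ ^ 2))).mono' ?_
    (Eventually.of_forall fun y => ?_)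
  · exact ((hu.comp (continuous_flow_right B T)).mul (Real.continuous_exp.comp
      ((continuous_logG _).comp (continuous_id.sub continuous_const)))).aestronglyMeasurable
  · rw [Real.norm_of_nonneg (mul_nonneg (h0 _) (Real.exp_pos _).le)]
    calc _ ≤ u (flow B T y) * Real.exp ((D + δ * ‖x‖ ^ 2) + -(δ / 2) * ‖y‖ ^ 2) := by
          refine mul_le_mul_of_nonneg_left (Real.exp_le_exp.2 ?_) (h0 _)
          have h1 := hD T hTI (y - x)
          have h2 := neg_mul_norm_sub_sq_le hδ.le x y
          linarith
      _ = _ := by rw [Real.exp_add]; ring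

/-- Under a Gaussian growth bound, local lower bounds propagate to the Gaussian averages: the
truncated masses are then almost conserved. -/
theorem mul_setIntegral_le_integral {A B P : Matrix (Fin N) (Fin N) ℝ}
    {u : EuclideanSpace ℝ (Fin N) → ℝ} (hA : A.PosSemidef) (hu : ContDiff ℝ ∞ u)
    (hL : ∀ x, L A B u x = 0) (h0 : ∀ x, 0 ≤ u x)
    (hC : ∀ t : ℝ, 0 < t → (C A B t).PosDef) (hP : P.PosDef) {T : ℝ} (hT : 0 ≤ T)
    (hgrowth : ∀ ε > 0, ∃ κ, ∀ t ∈ Icc 0 T,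
      Integrable (fun y => u (flow B t y) * Real.exp (-ε * ‖y‖ ^ 2)) ∧
      ∫ y, u (flow B t y) * Real.exp (-ε * ‖y‖ ^ 2) ≤ κ)
    (x : EuclideanSpace ℝ (Fin N)) {r c : ℝ} (hc : 0 ≤ c)
    (hball : ∀ y ∈ Metric.ball x r, c ≤ u y) :
    c * ∫ y in Metric.ball x r, Real.exp (logG P (y - x)) ≤
      ∫ y, u (flow B T y) * Real.exp (logG (cov A B P 0 T) (y - x)) := by
  obtain ⟨d, hd⟩ := exists_eq_sum_vecMulVec hA
  obtain ⟨κ, hκ⟩ := exists_dissipation_le d h0 hC hP hgrowth x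
  have hint := integrable_mul_exp_logG_cov hu.continuous h0 hC hP hT hgrowth x
  have cexp : Continuous fun y => Real.exp (logG P (y - x)) :=
    Real.continuous_exp.comp ((continuous_logG _).comp (continuous_id.sub continuous_const))
  have hvol : volume (Metric.ball x r) ≠ ⊤ := measure_ball_lt_top.ne
  have hexpint : IntegrableOn (fun y => Real.exp (logG P (y - x))) (Metric.ball x r) :=
    (cexp.continuousOn.integrableOn_compact (isCompact_closedBall x r)).mono_set
      Metric.ball_subset_closedBall
  have hmain : ∀ a > 0, c * ((∫ y in Metric.ball x r, Real.exp (logG P (y - x))) -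
      3 * a * volume.real (Metric.ball x r)) - κ * √a * T ≤
      ∫ y, u (flow B T y) * Real.exp (logG (cov A B P 0 T) (y - x)) := by
    intro a ha
    have h1 := mass_sub_mass_le hd hu hL hC hP x ha hT
      fun t ht => hκ a ha t (Ioo_subset_Icc_self ht)
    rw [sub_zero] at h1
    have h2 : mass A B P u x a 0 T ≤
        ∫ y, u (flow B T y) * Real.exp (logG (cov A B P 0 T) (y - x)) :=
      integral_mono (integrable_mass hC hP hu.continuous x ha hT) hint fun y =>
        mul_le_mul_of_nonneg_left (trunc_le_exp ha.le _) (h0 _)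
    have h3 : c * ((∫ y in Metric.ball x r, Real.exp (logG P (y - x))) -
        3 * a * volume.real (Metric.ball x r)) ≤ mass A B P u x a 0 0 := by
      have hi0 := integrable_mass hC hP hu.continuous x ha (le_refl 0)
      have h4 : ∫ y in Metric.ball x r, u (flow B 0 y) * trunc a (logG (cov A B P 0 0) (y - x)) ≤
          mass A B P u x a 0 0 :=
        setIntegral_le_integral hi0
          (Eventually.of_forall fun y => mul_nonneg (h0 _) (trunc_nonneg _ _))
      refine le_trans ?_ h4
      have h5 : c * ((∫ y in Metric.ball x r, Real.exp (logG P (y - x))) -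
          3 * a * volume.real (Metric.ball x r)) =
          ∫ y in Metric.ball x r, c * (Real.exp (logG P (y - x)) - 3 * a) := by
        rw [integral_const_mul, integral_sub hexpint (integrableOn_const (hs := hvol)),
          setIntegral_const, smul_eq_mul]
        ring
      rw [h5]
      refine setIntegral_mono_on ((hexpint.sub (integrableOn_const (hs := hvol))).const_mul c)
        hi0.integrableOn measurableSet_ball fun y hy => ?_
      rw [cov_self, flow_zero]
      calc c * (Real.exp (logG P (y - x)) - 3 * a) ≤ c * trunc a (logG P (y - x)) := by
            gcongr
            exact exp_sub_le_trunc ha.le _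
        _ ≤ u y * trunc a (logG P (y - x)) :=
            mul_le_mul_of_nonneg_right (hball y hy) (trunc_nonneg _ _)
    linarith
  have hlim : Tendsto (fun a : ℝ => c * ((∫ y in Metric.ball x r, Real.exp (logG P (y - x))) -
      3 * a * volume.real (Metric.ball x r)) - κ * √a * T) (𝓝[>] 0)
      (𝓝 (c * ((∫ y in Metric.ball x r, Real.exp (logG P (y - x))) -
      3 * 0 * volume.real (Metric.ball x r)) - κ * √0 * T)) := by
    refine tendsto_nhdsWithin_of_tendsto_nhds (Continuous.tendsto ?_ 0)
    fun_prop
  simp only [mul_zero, zero_mul, sub_zero, Real.sqrt_zero] at hlim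
  refine le_of_tendsto hlim ?_
  filter_upwards [self_mem_nhdsWithin] with a ha using hmain a ha

end Growth

/-! ### The Harnack inequality -/

section Harnack

variable {N : ℕ}

lemma neg_C_neg_posDef {A B : Matrix (Fin N) (Fin N) ℝ} (hC : ∀ t : ℝ, 0 < t → (C A B t).PosDef)
    {h : ℝ} (hh : 0 < h) : (-C A B (-h)).PosDef := by
  rw [neg_C_neg]
  exact posDef_E_mul_mul (hC h hh) B (-h)

/-- Comparison of two Gaussians with ordered covariances and different centres. -/
lemma logG_le_logG_add {S R : Matrix (Fin N) (Fin N) ℝ} (hS : S.PosDef) (hR : R.PosDef)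
    (z w : EuclideanSpace ℝ (Fin N)) :
    logG S z ≤ logG (S + R) (z + w) +
      (1 / 2 * Real.log (S + R).det - 1 / 2 * Real.log S.det + 1 / 4 * bil R⁻¹ w w) := by
  have := bil_inv_add_le hS hR z w
  simp only [logG]
  linarith

lemma tendsto_add_smul_one (M : Matrix (Fin N) (Fin N) ℝ) :
    Tendsto (fun η : ℝ => M + η • (1 : Matrix (Fin N) (Fin N) ℝ)) (𝓝[>] 0) (𝓝 M) := by
  have h : Tendsto (fun η : ℝ => M + η • (1 : Matrix (Fin N) (Fin N) ℝ)) (𝓝[>] 0)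
      (𝓝 (M + (0 : ℝ) • (1 : Matrix (Fin N) (Fin N) ℝ))) :=
    ((tendsto_nhdsWithin_of_tendsto_nhds tendsto_id).smul_const _).const_add M
  rwa [zero_smul, add_zero] at h

lemma tendsto_sub_smul_one (M : Matrix (Fin N) (Fin N) ℝ) :
    Tendsto (fun η : ℝ => M - η • (1 : Matrix (Fin N) (Fin N) ℝ)) (𝓝[>] 0) (𝓝 M) := by
  have h : Tendsto (fun η : ℝ => M - η • (1 : Matrix (Fin N) (Fin N) ℝ)) (𝓝[>] 0)
      (𝓝 (M - (0 : ℝ) • (1 : Matrix (Fin N) (Fin N) ℝ))) :=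
    ((tendsto_nhdsWithin_of_tendsto_nhds tendsto_id).smul_const _).const_sub M
  rwa [zero_smul, sub_zero] at h

lemma tendsto_log_det {α : Type*} {l : Filter α} {f : α → Matrix (Fin N) (Fin N) ℝ}
    {M : Matrix (Fin N) (Fin N) ℝ} (hf : Tendsto f l (𝓝 M)) (hM : M.det ≠ 0) :
    Tendsto (fun η => Real.log (f η).det) l (𝓝 (Real.log M.det)) :=
  (((continuous_id.matrix_det (n := Fin N) (R := ℝ)).tendsto M).comp hf).log hM

lemma tendsto_bil_inv {α : Type*} {l : Filter α} {f : α → Matrix (Fin N) (Fin N) ℝ}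
    {M : Matrix (Fin N) (Fin N) ℝ} (hf : Tendsto f l (𝓝 M)) (hM : M.det ≠ 0)
    (w : EuclideanSpace ℝ (Fin N)) :
    Tendsto (fun η => bil (f η)⁻¹ w w) l (𝓝 (bil M⁻¹ w w)) := by
  have h3 : Continuous fun M : Matrix (Fin N) (Fin N) ℝ => bil M w w :=
    continuous_id.bil continuous_const continuous_const
  exact (h3.tendsto _).comp ((continuousAt_matrix_inv hM).tendsto.comp hf)

lemma eventually_sub_smul_one_posDef {M : Matrix (Fin N) (Fin N) ℝ} (hM : M.PosDef) :
    ∀ᶠ η : ℝ in 𝓝[>] 0, (M - η • (1 : Matrix (Fin N) (Fin N) ℝ)).PosDef := by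
  obtain ⟨l, hl, hlM⟩ := exists_pos_mul_norm_sq_le_bil hM
  filter_upwards [Ioo_mem_nhdsGT hl] with η hη
  refine posDef_of_bil_pos (hM.isSymm_real.sub (isSymm_one.smul η)) fun z hz => ?_
  have h1 := hlM z
  have h2 : 0 < ‖z‖ ^ 2 := by positivity
  rw [bil_sub, bil_smul, bil_one, real_inner_self_eq_norm_sq]
  nlinarith [hη.2]

/-- **Harnack inequality**: `u x` is an average of `u ∘ exp(TB)` against a Gaussian of covariance
`C(T)`, and `u x'` dominates such an average with covariance `C(T) - C(-h)`. -/
theorem le_exp_mul {A B : Matrix (Fin N) (Fin N) ℝ}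
    {u : EuclideanSpace ℝ (Fin N) → ℝ} (hA : A.PosSemidef) (hu : ContDiff ℝ ∞ u)
    (hL : ∀ x, L A B u x = 0) (h0 : ∀ x, 0 ≤ u x)
    (hC : ∀ t : ℝ, 0 < t → (C A B t).PosDef)
    (hK : ∀ l : ℝ, ∀ᶠ h in atTop, ∀ z, l * ‖z‖ ^ 2 ≤ bil (-C A B (-h)) z z)
    (x x' : EuclideanSpace ℝ (Fin N)) {T h : ℝ} (hT : 0 < T) (hh : 0 < h) :
    u x ≤ Real.exp (1 / 2 * Real.log (C A B T - C A B (-h)).det -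
      1 / 2 * Real.log (C A B T).det +
      1 / 4 * bil (-C A B (-h))⁻¹ (x - flow B h x') (x - flow B h x')) * u x' := by
  set w := x - flow B h x' with hw
  have hKpos := neg_C_neg_posDef hC hh
  have hgrowth := fun ε (hε : 0 < ε) => exists_integral_exp_neg_le hA hu hL h0 hC hK hε T
  have hx' : u (flow B (-h) (flow B h x')) = u x' := by rw [flow_neg_flow]
  have hsup := lintegral_gaussian_le hA hu hL h0 hC (flow B h x') (show -h < T by linarith)
  rw [hx'] at hsup
  have cv : Continuous fun y => u (flow B T y) := hu.continuous.comp (continuous_flow_right B T)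
  have cg : Continuous fun y => u (flow B T y) *
      Real.exp (logG (C A B T - C A B (-h)) (y - flow B h x')) :=
    cv.mul (Real.continuous_exp.comp ((continuous_logG _).comp
      (continuous_id.sub continuous_const)))
  have hnn : ∀ y, 0 ≤ u (flow B T y) *
      Real.exp (logG (C A B T - C A B (-h)) (y - flow B h x')) := fun y =>
    mul_nonneg (h0 _) (Real.exp_pos _).le
  have hgi : Integrable fun y => u (flow B T y) *
      Real.exp (logG (C A B T - C A B (-h)) (y - flow B h x')) :=
    (lintegral_ofReal_ne_top_iff_integrable cg.aestronglyMeasurable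
      (Eventually.of_forall hnn)).1 (ne_top_of_le_ne_top ENNReal.ofReal_ne_top hsup)
  have hgle : ∫ y, u (flow B T y) * Real.exp (logG (C A B T - C A B (-h)) (y - flow B h x')) ≤
      u x' * gaussMass N := by
    rw [integral_eq_lintegral_of_nonneg_ae (Eventually.of_forall hnn) cg.aestronglyMeasurable]
    exact ENNReal.toReal_le_of_le_ofReal (mul_nonneg (h0 _) (gaussMass_pos N).le) hsup
  let m : ℝ → ℝ := fun η => 1 / 2 * Real.log (C A B T - C A B (-h)).det -
    1 / 2 * Real.log (C A B T + η • (1 : Matrix (Fin N) (Fin N) ℝ)).det +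
    1 / 4 * bil (-C A B (-h) - η • (1 : Matrix (Fin N) (Fin N) ℝ))⁻¹ w w
  have hm : Tendsto m (𝓝[>] 0) (𝓝 (1 / 2 * Real.log (C A B T - C A B (-h)).det -
      1 / 2 * Real.log (C A B T).det + 1 / 4 * bil (-C A B (-h))⁻¹ w w)) :=
    (tendsto_const_nhds.sub ((tendsto_log_det (tendsto_add_smul_one _)
      (hC T hT).det_pos.ne').const_mul _)).add
      ((tendsto_bil_inv (tendsto_sub_smul_one _) hKpos.det_pos.ne' w).const_mul _)
  -- any `c < u x` is a lower bound for `u` near `x`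
  have hmain : ∀ c, 0 ≤ c → c < u x → c ≤ Real.exp (1 / 2 * Real.log (C A B T - C A B (-h)).det -
      1 / 2 * Real.log (C A B T).det + 1 / 4 * bil (-C A B (-h))⁻¹ w w) * u x' := by
    intro c hc hcu
    obtain ⟨r, hr, hball⟩ := Metric.mem_nhds_iff.1
      (hu.continuous.continuousAt.eventually (lt_mem_nhds hcu))
    have hlim1 := (tendsto_setIntegral_exp_logG_smul_one hr x).const_mul c
    have hlim2 := ((Real.continuous_exp.tendsto _).comp hm).mul_const (u x' * gaussMass N)
    have hle : c * gaussMass N ≤ Real.exp (1 / 2 * Real.log (C A B T - C A B (-h)).det -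
        1 / 2 * Real.log (C A B T).det + 1 / 4 * bil (-C A B (-h))⁻¹ w w) *
          (u x' * gaussMass N) := by
      refine le_of_tendsto_of_tendsto hlim1 hlim2 ?_
      filter_upwards [eventually_sub_smul_one_posDef hKpos, self_mem_nhdsWithin] with η hη hηpos
      have hP := smul_one_posDef (N := N) hηpos
      have hcov : cov A B (η • 1) 0 T = C A B T + η • (1 : Matrix (Fin N) (Fin N) ℝ) := by
        rw [cov, C_zero, sub_zero, add_comm]
      have h1 := mul_setIntegral_le_integral hA hu hL h0 hC hP hT.le hgrowth x hc
        (r := r) fun y hy => (hball hy).le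
      refine h1.trans ?_
      calc ∫ y, u (flow B T y) * Real.exp (logG (cov A B (η • 1) 0 T) (y - x))
          ≤ ∫ y, Real.exp (m η) * (u (flow B T y) *
              Real.exp (logG (C A B T - C A B (-h)) (y - flow B h x'))) := by
            refine integral_mono (integrable_mul_exp_logG_cov hu.continuous h0 hC hP hT.le
              hgrowth x) (hgi.const_mul _) fun y => ?_
            have h2 := logG_le_logG_add (hcov ▸ cov_posDef hC hP hT.le) hη (y - x) w
            have h3 : C A B T + η • (1 : Matrix (Fin N) (Fin N) ℝ) + (-C A B (-h) - η • 1) =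
                C A B T - C A B (-h) := by abel
            have h4 : y - x + w = y - flow B h x' := by rw [hw]; abel
            rw [h3, h4] at h2
            simp only [hcov]
            calc u (flow B T y) * Real.exp (logG (C A B T + η • 1) (y - x))
                ≤ u (flow B T y) * Real.exp (logG (C A B T - C A B (-h)) (y - flow B h x') +
                    m η) := mul_le_mul_of_nonneg_left (Real.exp_le_exp.2 h2) (h0 _)
              _ = _ := by rw [Real.exp_add]; ring
        _ = Real.exp (m η) * ∫ y, (u (flow B T y) *
              Real.exp (logG (C A B T - C A B (-h)) (y - flow B h x'))) := integral_const_mul _ _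
        _ ≤ Real.exp (m η) * (u x' * gaussMass N) := by gcongr
    rw [← mul_assoc] at hle
    exact le_of_mul_le_mul_right hle (gaussMass_pos N)
  rcases (h0 x).eq_or_lt with hx | hx
  · rw [← hx]
    exact mul_nonneg (Real.exp_pos _).le (h0 _)
  · refine le_of_forall_lt_imp_le_of_dense fun c hcu => ?_
    rcases le_total 0 c with hc | hc
    · exact hmain c hc hcu
    · exact hc.trans (mul_nonneg (Real.exp_pos _).le (h0 _))

end Harnack

/-! ### The Liouville property -/

section Liouville

variable {N : ℕ}

open scoped Matrix.Norms.L2Operator in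
lemma tendsto_C_inv {A B : Matrix (Fin N) (Fin N) ℝ} (hC : ∀ t : ℝ, 0 < t → (C A B t).PosDef)
    (hCtop : ∀ l : ℝ, ∀ᶠ t in atTop, ∀ z, l * ‖z‖ ^ 2 ≤ bil (C A B t) z z) :
    Tendsto (fun t => (C A B t)⁻¹) atTop (𝓝 0) := by
  refine tendsto_zero_iff_norm_tendsto_zero.2 (Metric.tendsto_nhds.2 fun ε hε => ?_)
  filter_upwards [hCtop (2 / ε), eventually_gt_atTop 0] with t ht ht0
  have := norm_inv_le_of_le_bil (hC t ht0) (by positivity) ht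
  rw [Real.dist_eq, sub_zero, abs_norm]
  refine this.trans_lt ?_
  rw [inv_div]
  linarith

/-- Adding a fixed matrix to a covariance exhausting all directions does not change its determinant
asymptotically. -/
lemma tendsto_log_det_sub {A B : Matrix (Fin N) (Fin N) ℝ}
    (hC : ∀ t : ℝ, 0 < t → (C A B t).PosDef)
    (hCtop : ∀ l : ℝ, ∀ᶠ t in atTop, ∀ z, l * ‖z‖ ^ 2 ≤ bil (C A B t) z z)
    {h : ℝ} (hh : 0 < h) :
    Tendsto (fun t => 1 / 2 * Real.log (C A B t - C A B (-h)).det -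
      1 / 2 * Real.log (C A B t).det) atTop (𝓝 0) := by
  have h1 : Tendsto (fun t => (1 : Matrix (Fin N) (Fin N) ℝ) + (C A B t)⁻¹ * (-C A B (-h))) atTop
      (𝓝 (1 + 0 * (-C A B (-h)))) :=
    ((tendsto_C_inv hC hCtop).mul_const _).const_add _
  rw [zero_mul, add_zero] at h1
  have h2 := (tendsto_log_det h1 (by simp)).const_mul (1 / 2)
  rw [det_one, Real.log_one, mul_zero] at h2
  refine h2.congr' ?_
  filter_upwards [eventually_gt_atTop 0] with t ht
  have h3 : C A B t - C A B (-h) = C A B t * (1 + (C A B t)⁻¹ * (-C A B (-h))) := by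
    rw [mul_add, mul_one, ← mul_assoc, mul_inv_cancel_of_posDef (hC t ht), one_mul,
      sub_eq_add_neg]
  have hd := (C_sub_posDef hC (show -h < t by linarith)).det_pos.ne'
  have hd1 := hd
  rw [h3, det_mul] at hd1
  rw [h3, det_mul, Real.log_mul (left_ne_zero_of_mul hd1) (right_ne_zero_of_mul hd1)]
  ring

/-- The inverse of the past covariance `-C(-h)`, transported by the flow, is at most that of the
future covariance `C(h)`. -/
lemma bil_neg_C_neg_inv_flow_le {A B : Matrix (Fin N) (Fin N) ℝ}
    (hC : ∀ t : ℝ, 0 < t → (C A B t).PosDef) {h : ℝ} (hh : 0 < h)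
    (y : EuclideanSpace ℝ (Fin N)) :
    bil (-C A B (-h))⁻¹ (flow B h y) (flow B h y) ≤ bil (C A B h)⁻¹ y y := by
  rw [bil_inv_eq (neg_C_neg_posDef hC hh)]
  set p := toEuclideanCLM (𝕜 := ℝ) (-C A B (-h))⁻¹ (flow B h y)
  have h1 := two_inner_sub_bil_le (hC h hh) (toEuclideanCLM (𝕜 := ℝ) (E B (-h))ᵀ p) y
  have h2 : bil (-C A B (-h)) p p = bil (C A B h) (toEuclideanCLM (𝕜 := ℝ) (E B (-h))ᵀ p)
      (toEuclideanCLM (𝕜 := ℝ) (E B (-h))ᵀ p) := by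
    rw [neg_C_neg, bil_mul_right, bil_mul_left]
  have h3 : inner ℝ p (flow B h y) = inner ℝ (toEuclideanCLM (𝕜 := ℝ) (E B (-h))ᵀ p) y := by
    have := bil_mul_left (E B (-h)) 1 p y
    rw [mul_one, bil_one] at this
    exact this
  rw [h2, h3]
  exact h1

/-- Nonnegative `ℒ`-harmonic functions are constant as soon as the covariances of both the future
and the past exhaust all directions. -/
theorem le_of_nonneg_of_harmonic {A B : Matrix (Fin N) (Fin N) ℝ}
    {u : EuclideanSpace ℝ (Fin N) → ℝ} (hA : A.PosSemidef) (hu : ContDiff ℝ ∞ u)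
    (hL : ∀ x, L A B u x = 0) (h0 : ∀ x, 0 ≤ u x)
    (hC : ∀ t : ℝ, 0 < t → (C A B t).PosDef)
    (hCtop : ∀ l : ℝ, ∀ᶠ t in atTop, ∀ z, l * ‖z‖ ^ 2 ≤ bil (C A B t) z z)
    (hK : ∀ l : ℝ, ∀ᶠ h in atTop, ∀ z, l * ‖z‖ ^ 2 ≤ bil (-C A B (-h)) z z)
    (x x' : EuclideanSpace ℝ (Fin N)) : u x ≤ u x' := by
  -- send the final time to infinity
  have hstep : ∀ h > 0, u x ≤ Real.exp (1 / 4 *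
      bil (-C A B (-h))⁻¹ (x - flow B h x') (x - flow B h x')) * u x' := by
    intro h hh
    have h1 := ((Real.continuous_exp.tendsto _).comp ((tendsto_log_det_sub hC hCtop hh).add_const
      (1 / 4 * bil (-C A B (-h))⁻¹ (x - flow B h x') (x - flow B h x')))).mul_const (u x')
    rw [zero_add] at h1
    refine ge_of_tendsto h1 ?_
    filter_upwards [eventually_gt_atTop 0] with T hT
      using le_exp_mul hA hu hL h0 hC hK x x' hT hh
  -- send the initial time to `-∞`
  refine le_of_forall_pos_le_add fun ε hε => ?_
  have hlim : Tendsto (fun s : ℝ => Real.exp s * u x') (𝓝 0) (𝓝 (Real.exp 0 * u x')) :=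
    (Real.continuous_exp.tendsto 0).mul_const _
  rw [Real.exp_zero, one_mul] at hlim
  obtain ⟨δ, hδ, hball⟩ := Metric.mem_nhds_iff.1 (hlim.eventually (gt_mem_nhds
    (show u x' < u x' + ε by linarith)))
  set R := ‖x‖ ^ 2 + ‖x'‖ ^ 2 with hR
  have hl : 0 < (R + 1) / δ := by positivity
  obtain ⟨h, ⟨hh1, hh2⟩, hh⟩ := ((hCtop ((R + 1) / δ)).and (hK ((R + 1) / δ))).and
    (eventually_gt_atTop 0) |>.exists
  have hKpos := neg_C_neg_posDef hC hh
  set q := bil (-C A B (-h))⁻¹ (x - flow B h x') (x - flow B h x') with hq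
  have hq0 : 0 ≤ q := bil_nonneg hKpos.inv.posSemidef _
  have hqle : q ≤ 2 * bil (-C A B (-h))⁻¹ x x +
      2 * bil (-C A B (-h))⁻¹ (flow B h x') (flow B h x') := by
    have := bil_nonneg hKpos.inv.posSemidef (x + flow B h x')
    simp only [bil_add_left, bil_add_right] at this
    simp only [hq, bil_sub_left, bil_sub_right]
    linarith
  have e1 := bil_inv_le_norm_sq_div hKpos hl hh2 x
  have e2 := (bil_neg_C_neg_inv_flow_le hC hh x').trans
    (bil_inv_le_norm_sq_div (hC h hh) hl hh1 x')
  have e3 : ‖x‖ ^ 2 / ((R + 1) / δ) + ‖x'‖ ^ 2 / ((R + 1) / δ) < δ := by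
    rw [← add_div, ← hR, div_lt_iff₀ hl, mul_div_cancel₀ _ hδ.ne']
    linarith
  have hmem : 1 / 4 * q ∈ Metric.ball (0 : ℝ) δ := by
    rw [Metric.mem_ball, dist_zero_right, Real.norm_of_nonneg (by positivity)]
    linarith
  exact (hstep h hh).trans (le_of_lt (hball hmem))

lemma L_sub_const (A B : Matrix (Fin N) (Fin N) ℝ) {u : EuclideanSpace ℝ (Fin N) → ℝ}
    (hu : ContDiff ℝ ∞ u) (hA : A.PosSemidef) (c : ℝ) (x : EuclideanSpace ℝ (Fin N)) :
    L A B (fun y => u y - c) x = L A B u x := by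
  obtain ⟨d, hd⟩ := exists_eq_sum_vecMulVec hA
  rw [L_eq_sum hd hu, L_eq_sum hd (hu.sub contDiff_const)]
  have h1 : fderiv ℝ (fun y => u y - c) = fderiv ℝ u := by
    funext y
    exact fderiv_sub_const c
  have h2 : ∀ b, dirDeriv (fun y => u y - c) b = dirDeriv u b := by
    intro b
    funext y
    rw [dirDeriv, h1, dirDeriv]
  simp only [dirDeriv₂, h2, h1]

theorem oneSideLiouville_of_spectrum_imaginary {A B : Matrix (Fin N) (Fin N) ℝ}
    (hA : A.PosSemidef) (hC : ∀ t : ℝ, 0 < t → (C A B t).PosDef)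
    (hB : ∀ z ∈ spectrum ℂ (B.map (algebraMap ℝ ℂ)), z.re = 0) : OneSideLiouville A B := by
  intro u
  constructor
  · rintro ⟨hu, hL, m, hm⟩
    have hCtop := eventually_le_bil_C hA hC hB
    have hC' : ∀ t : ℝ, 0 < t → (C A (-B) t).PosDef := fun t ht => by
      rw [C_neg_left]
      exact neg_C_neg_posDef hC ht
    have hB' : ∀ z ∈ spectrum ℂ ((-B).map (algebraMap ℝ ℂ)), z.re = 0 := by
      intro z hz
      have h1 : (-B).map (algebraMap ℝ ℂ) = -B.map (algebraMap ℝ ℂ) := by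
        ext i j
        simp
      rw [h1, ← spectrum.neg_eq, Set.mem_neg] at hz
      simpa using hB _ hz
    have hK : ∀ l : ℝ, ∀ᶠ h in atTop, ∀ z, l * ‖z‖ ^ 2 ≤ bil (-C A B (-h)) z z := by
      intro l
      filter_upwards [eventually_le_bil_C hA hC' hB' l] with h hh z
      rw [← C_neg_left]
      exact hh z
    have hle := le_of_nonneg_of_harmonic (u := fun y => u y - m) hA (hu.sub contDiff_const)
      (fun x => by rw [L_sub_const A B hu hA, hL]) (fun x => sub_nonneg.2 (hm ⟨x, rfl⟩)) hC
      hCtop hK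
    exact ⟨u 0, fun x => le_antisymm (by linarith [hle x 0]) (by linarith [hle 0 x])⟩
  · rintro ⟨c, hc⟩
    obtain rfl : u = fun _ => c := funext hc
    refine ⟨contDiff_const, fun x => ?_, c, ?_⟩
    · obtain ⟨d, hd⟩ := exists_eq_sum_vecMulVec hA
      rw [L_eq_sum hd contDiff_const]
      have h1 : ∀ b, dirDeriv (fun _ : EuclideanSpace ℝ (Fin N) => c) b = fun _ => 0 := by
        intro b
        funext y
        simp [dirDeriv]
      simp [dirDeriv₂, h1]
    · rintro _ ⟨x, rfl⟩
      exact le_rfl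

end Liouville

end OrnsteinUhlenbeck

theorem theorem1p1 (N : ℕ) (A B : Matrix (Fin N) (Fin N) ℝ)
    (hA : A.PosSemidef)
    (hC : ∀ t : ℝ, 0 < t → (OrnsteinUhlenbeck.C A B t).PosDef)
    (hB : ∀ z ∈ spectrum ℂ (B.map (algebraMap ℝ ℂ)), z.re = 0) :
    OrnsteinUhlenbeck.OneSideLiouville A B :=
  OrnsteinUhlenbeck.oneSideLiouville_of_spectrum_imaginary hA hC hB
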